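/- **Setting.** Let $d\ge 1$. A $d$-dimensional Lipschitz Riemannian (LR) manifold $(M,g)$ is a connected, second countable Hausdorff space $M$ with a countable atlas $(U_\alpha,\Phi_\alpha)_{\alpha\in A}$ of homeomorphisms $\Phi_\alpha$ from open sets $U_\alpha\subset M$ covering $M$ onto open subsets of $\mathbb R^d$ or of $\mathbb R^{d-1}\times[0,\infty)$ with locally Lipschitz transition maps, together with a family $g=(g_\alpha)$ of scalar products $g_\alpha(z)$, $z\in\Phi_\alpha(U_\alpha)$, with Borel coefficients, which are mapped to each other by the transition maps $\mathcal L^d$-a.e., and such that for every $\alpha$ there is $c_\alpha\ge 1$ with $c_\alpha^{-1}\|\omega\|_{L^2(\mathrm{Eucl})}\le\|\omega\|_{L^2(g_\alpha)}\le c_\alpha\|\omega\|_{L^2(\mathrm{Eucl})}$ for all smooth one-forms $\omega$ with compact support in $\Phi_\alpha(U_\alpha)$. In particular $M$ may have a boundary. A *chart* of $M$ is any homeomorphism $\Phi$ from an open set $U\subset M$ onto an open subset of $\mathbb R^d$ or $\mathbb R^{d-1}\times[0,\infty)$ whose transition maps from and to the charts of the atlas are locally Lipschitz; $g^{U}$ denotes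 the metric $g$ read in this chart (defined $\mathcal L^d$-a.e. on $\Phi(U)$). The volume measure $\mathrm{vol}$ is given by $\sqrt{\det g_\alpha}\,d\mathcal L^d$ in the chart $\alpha$. The distance is $\mathsf d(x,y)=\sup_{B}\inf_\gamma L(\gamma)$, where $B$ runs over the $\mathrm{vol}$-null subsets of $M$ and $\gamma$ over the Lipschitz curves $[0,1]\to M$ from $x$ to $y$ which spend zero time in $B$ and in the null set on which the transition maps fail to be differentiable or to respect $g$, and $L$ is the length with respect to $g$. Let $\mathsf B_r(x)=\{y:\mathsf d(x,y)<r\}$. For $b>1$ and $x\in M$, the Euclidean radius $r_{\mathrm E}(x,b)\in[0,\infty]$ is the supremum (with $\sup\emptyset=0$) of all $r>0$ such that $\mathsf B_r(x)$ is relatively compact and there is a chart $(U,\Phi)$ around $x$ with $\mathsf B_r(x)\subset U$, with $\Phi(\mathsf B_r(x))$ open in $\mathbb R^d$ or $\mathbb R^{d-1}\times[0,\infty)$, and with $b^{-1}|\xi|^2\le g^U(\xi,\xi)\le b|\xi|^2$ for every $\xi\in\mathbb R^d$, $\mathcal L^d$-a.e. on $\Phi(\mathsf B_r(x))$. For open $O\subset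 M$, let $\lambda_1(O)$ be the first eigenvalue of the Dirichlet Laplacian on $O$, $$\lambda_1(O)=\inf\Big\{\frac{\int_M|df|^2\,d\mathrm{vol}}{\int_M f^2\,d\mathrm{vol}}\;:\; f \text{ Lipschitz with compact support in } O,\ 0<\int_M f^2\,d\mathrm{vol}<\infty\Big\};$$ no vanishing is required on $O\cap\partial M$. **Lemma.** For every $d\ge1$ and every $b>1$ there is a constant $a>0$, depending only on $b$ and $d$, such that the following holds for every $d$-dimensional LR manifold $(M,g)$, every $\varepsilon_1>0$ and every $\varepsilon_2>1$. With $$R(y):=\frac{\min\{r_{\mathrm E}(y,b),\varepsilon_1\}}{\varepsilon_2},\qquad y\in M,$$ for every $x\in M$ the ball $\mathsf B_{R(x)}(x)$ is relatively compact, and for every nonempty open set $O\subset\mathsf B_{R(x)}(x)$, $$\lambda_1(O)\ \ge\ a\,\mathrm{vol}[O]^{-2/d}.$$ -/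

import Mathlib

open Set MeasureTheory
open scoped ENNReal NNReal Matrix

universe u

namespace LRMfd

noncomputable section

/-- `ℝ^d` with the Euclidean norm. -/
abbrev E (d : ℕ) : Type := EuclideanSpace ℝ (Fin d)

/-- The closed half-space `ℝ^{d-1} × [0,∞)`; `Fin.rev 0` is the last index. -/
def halfSpace (d : ℕ) [NeZero d] : Set (E d) := {z | 0 ≤ z (Fin.rev 0)}

/-- `V` is an open subset of `ℝ^d` or an open subset of `ℝ^{d-1} × [0,∞)`. -/
def IsModelOpen {d : ℕ} [NeZero d] (V : Set (E d)) : Prop :=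
  IsOpen V ∨ ∃ W : Set (E d), IsOpen W ∧ V = W ∩ halfSpace d

/-- `φ` is a topological chart: a homeomorphism from an open subset `φ.source` of `M` onto an
open subset `φ.target` of `ℝ^d` or of `ℝ^{d-1} × [0,∞)`. -/
structure IsChart {d : ℕ} [NeZero d] {M : Type u} [TopologicalSpace M]
    (φ : PartialEquiv M (E d)) : Prop where
  isOpen_source : IsOpen φ.source
  isModelOpen_target : IsModelOpen φ.target
  continuousOn : ContinuousOn φ φ.source
  continuousOn_symm : ContinuousOn φ.symm φ.target

/-- The transition map `ψ ∘ φ⁻¹ : φ(U ∩ V) → ψ(U ∩ V)` is locally Lipschitz, where `U`, `V` are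
the domains of `φ`, `ψ`. (The source of `φ.symm.trans ψ` is `φ(U ∩ V)`.) -/
def LipTransition {d : ℕ} {M : Type u} (φ ψ : PartialEquiv M (E d)) : Prop :=
  LocallyLipschitzOn (φ.symm.trans ψ).source (φ.symm.trans ψ)

/-- The bilinear form `(ξ, η) ↦ ξᵀ G η` of a matrix. -/
def form {d : ℕ} (G : Matrix (Fin d) (Fin d) ℝ) (ξ η : E d) : ℝ :=
  (fun i => ξ i) ⬝ᵥ (G *ᵥ fun i => η i)

/-- The co-metric of the scalar product with matrix `G`: the squared norm `θᵀ G⁻¹ θ` of the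
covector with coefficients `θ`. -/
def conormSq {d : ℕ} (G : Matrix (Fin d) (Fin d) ℝ) (θ : Fin d → ℝ) : ℝ :=
  θ ⬝ᵥ (G⁻¹ *ᵥ θ)

/-- The coefficients of the differential at `z` of a function `h` on `ℝ^d`. -/
def dCoeff {d : ℕ} (h : E d → ℝ) (z : E d) : Fin d → ℝ :=
  fun i => fderiv ℝ h z (EuclideanSpace.single i 1)

/-- `θ` (given by its coefficients) is a smooth one-form on `V` with compact support in `V`;
if `V` is open in the half-space only, smoothness means the existence of a smooth extension,
and `θ` is such an extension, only its restriction to `V` being of importance. -/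
def IsTestForm {d : ℕ} (V : Set (E d)) (θ : E d → Fin d → ℝ) : Prop :=
  ContDiff ℝ (⊤ : ℕ∞) θ ∧ ∃ K : Set (E d), IsCompact K ∧ K ⊆ V ∧ ∀ z ∈ V \ K, θ z = 0

/-- The structure of a `d`-dimensional Lipschitz Riemannian manifold on the topological space `M`:
a countable atlas with locally Lipschitz transition maps, and a Riemannian metric with Borel
coefficients in every chart, compatible with the transition maps, and subject to the local
Lipschitz condition on one-forms. -/
structure LRStructure (d : ℕ) [NeZero d] (M : Type u) [TopologicalSpace M] where
  /-- index set of the atlas -/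
  A : Type
  countable_A : Countable A
  /-- the charts `(U_α, Φ_α)`, where `U_α` is `(chart α).source` -/
  chart : A → PartialEquiv M (E d)
  isChart : ∀ α, IsChart (chart α)
  cover : ∀ p : M, ∃ α, p ∈ (chart α).source
  lipTransition : ∀ α β, LipTransition (chart α) (chart β)
  /-- the matrix of the scalar product `g_α(z)`, of significance for `z ∈ Φ_α(U_α)` -/
  g : A → E d → Matrix (Fin d) (Fin d) ℝ
  measurable_g : ∀ α i j, Measurable fun z => g α z i j
  posDef_g : ∀ α, ∀ z ∈ (chart α).target, (g α z).PosDef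
  /-- `(Φ_{α,β})_* g_α = g_β` almost everywhere on `Φ_β(U_α ∩ U_β)` -/
  compatible : ∀ α β, ∀ᵐ w : E d, w ∈ ((chart β).symm.trans (chart α)).source →
    ∀ ξ η : E d, form (g β w) ξ η =
      form (g α ((chart β).symm.trans (chart α) w))
        (fderiv ℝ ((chart β).symm.trans (chart α)) w ξ)
        (fderiv ℝ ((chart β).symm.trans (chart α)) w η)
  /-- `c⁻¹ ‖θ‖_{Euclid} ≤ ‖θ‖_{g_α} ≤ c ‖θ‖_{Euclid}`, with all norms squared -/
  locallyLipschitz : ∀ α, ∃ c : ℝ≥0, 1 ≤ c ∧ ∀ θ, IsTestForm (chart α).target θ →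
    (∫⁻ z in (chart α).target, ENNReal.ofReal (θ z ⬝ᵥ θ z)) ≤
        (c : ℝ≥0∞) ^ 2 * ∫⁻ z in (chart α).target,
          ENNReal.ofReal (conormSq (g α z) (θ z) * √(g α z).det) ∧
    (∫⁻ z in (chart α).target, ENNReal.ofReal (conormSq (g α z) (θ z) * √(g α z).det)) ≤
        (c : ℝ≥0∞) ^ 2 * ∫⁻ z in (chart α).target, ENNReal.ofReal (θ z ⬝ᵥ θ z)

namespace LRStructure

variable {d : ℕ} [NeZero d] {M : Type u} [TopologicalSpace M]

section Volume

variable [MeasurableSpace M]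

/-- The measure `√(det g_α) dz` on `Φ_α(U_α)`, transported to `U_α`. -/
def chartVol (S : LRStructure d M) (α : S.A) : Measure M :=
  ((volume.restrict (S.chart α).target).withDensity
    fun z => ENNReal.ofReal √(S.g α z).det).map (S.chart α).symm

/-- The volume measure. By compatibility, the measures `chartVol α` and `chartVol β` agree on
`U_α ∩ U_β`, so their least upper bound is the measure on `M` which restricts to `chartVol α`
on every `U_α`. -/
def vol (S : LRStructure d M) : Measure M := ⨆ α, S.chartVol α

end Volume

section Curves

/-- `γ` restricts to a Lipschitz curve `[0,1] → M` from `x` to `y`. -/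
structure IsLipCurve (S : LRStructure d M) (γ : ℝ → M) (x y : M) : Prop where
  continuousOn : ContinuousOn γ (Icc 0 1)
  lipschitz : ∀ (α : S.A) (s t : ℝ), 0 ≤ s → s ≤ t → t ≤ 1 →
    MapsTo γ (Icc s t) (S.chart α).source →
      ∃ K : ℝ≥0, LipschitzOnWith K (fun τ => S.chart α (γ τ)) (Icc s t)
  start : γ 0 = x
  finish : γ 1 = y

/-- The exceptional set: the points where some transition map is not differentiable or does not
transform the metric correctly. It is negligible, and a Lipschitz curve that spends almost no
time in it has, at almost every time, the same speed in all charts. -/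
def badSet (S : LRStructure d M) : Set M :=
  {p | ∃ α β, p ∈ (S.chart α).source ∧ p ∈ (S.chart β).source ∧
    ¬ ∃ D : E d →L[ℝ] E d,
      HasFDerivWithinAt ((S.chart α).symm.trans (S.chart β)) D
        ((S.chart α).symm.trans (S.chart β)).source (S.chart α p) ∧
      ∀ ξ η, form (S.g α (S.chart α p)) ξ η = form (S.g β (S.chart β p)) (D ξ) (D η)}

/-- The speed `√(g_α(γ_α', γ_α'))` at time `t` of `γ_α = Φ_α ∘ γ`. -/
def chartSpeed (S : LRStructure d M) (γ : ℝ → M) (α : S.A) (t : ℝ) : ℝ :=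
  √(form (S.g α (S.chart α (γ t))) (deriv (fun s => S.chart α (γ s)) t)
    (deriv (fun s => S.chart α (γ s)) t))

/-- The length of a curve: the integral over `[0,1]` of its speed, which is computed in the charts
around `γ t` (all of them give the same value for almost every `t`, see `badSet`). -/
def length (S : LRStructure d M) (γ : ℝ → M) : ℝ≥0∞ :=
  ∫⁻ t in Icc (0 : ℝ) 1,
    ⨆ (α : S.A) (_ : γ t ∈ (S.chart α).source), ENNReal.ofReal (S.chartSpeed γ α t)

/-- The infimum of the lengths of Lipschitz curves from `x` to `y` transversal to `B` and to the
exceptional set, i.e. spending almost no time there. -/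
def pathDistAvoiding (S : LRStructure d M) (B : Set M) (x y : M) : ℝ≥0∞ :=
  ⨅ (γ : ℝ → M) (_ : S.IsLipCurve γ x y ∧
      volume (Icc (0 : ℝ) 1 ∩ γ ⁻¹' (B ∪ S.badSet)) = 0), S.length γ

variable [MeasurableSpace M]

/-- The path distance induced by the Riemannian metric. -/
def pathDist (S : LRStructure d M) (x y : M) : ℝ≥0∞ :=
  ⨆ (B : Set M) (_ : S.vol B = 0), S.pathDistAvoiding B x y

/-- The open ball of radius `r` around `x` for the path distance. -/
def ball (S : LRStructure d M) (x : M) (r : ℝ) : Set M :=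
  {y | S.pathDist x y < ENNReal.ofReal r}

end Curves

section EuclideanRadius

/-- `φ` is a chart of the Lipschitz manifold: a topological chart whose transition maps from and
to the charts of the atlas are locally Lipschitz. -/
def IsLipChart (S : LRStructure d M) (φ : PartialEquiv M (E d)) : Prop :=
  IsChart φ ∧ ∀ α, LipTransition φ (S.chart α) ∧ LipTransition (S.chart α) φ

/-- The Riemannian metric on the image of a chart `φ`, evaluated at `z` on `(ξ, η)` by means of
the chart `α` of the atlas around `φ⁻¹(z)`: for almost every `z` the value does not depend on `α`,
and for a chart `φ` of the atlas it is the given metric. -/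
def metricInChart (S : LRStructure d M) (φ : PartialEquiv M (E d)) (α : S.A)
    (z ξ η : E d) : ℝ :=
  form (S.g α (φ.symm.trans (S.chart α) z))
    (fderiv ℝ (φ.symm.trans (S.chart α)) z ξ) (fderiv ℝ (φ.symm.trans (S.chart α)) z η)

variable [MeasurableSpace M]

/-- The radius `r` is admissible in the definition of the Euclidean radius at `x`. -/
structure IsAdmissible (S : LRStructure d M) (b : ℝ) (x : M) (r : ℝ) : Prop where
  pos : 0 < r
  relativelyCompact : IsCompact (closure (S.ball x r))
  exists_chart : ∃ φ : PartialEquiv M (E d), S.IsLipChart φ ∧ x ∈ φ.source ∧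
    S.ball x r ⊆ φ.source ∧ IsModelOpen (φ '' S.ball x r) ∧
    ∀ α, ∀ᵐ z : E d, z ∈ φ '' (S.ball x r ∩ (S.chart α).source) → ∀ ξ : E d,
      b⁻¹ * ‖ξ‖ ^ 2 ≤ S.metricInChart φ α z ξ ξ ∧ S.metricInChart φ α z ξ ξ ≤ b * ‖ξ‖ ^ 2

/-- The Euclidean radius `r_E(x,b) ∈ [0,∞]`: the supremum of all admissible radii. -/
def euclRadius (S : LRStructure d M) (x : M) (b : ℝ) : ℝ≥0∞ :=
  ⨆ (r : ℝ) (_ : S.IsAdmissible b x r), ENNReal.ofReal r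

/-- `R(y) = min {r_E(y,b), ε₁} / ε₂`. -/
def R (S : LRStructure d M) (b ε₁ ε₂ : ℝ) (y : M) : ℝ :=
  (min (S.euclRadius y b) (ENNReal.ofReal ε₁)).toReal / ε₂

end EuclideanRadius

section Dirichlet

/-- `f` is a Lipschitz function with compact support in the open set `O`. (For compactly supported
functions, Lipschitz means that `f ∘ Φ_α⁻¹` is locally Lipschitz for every `α`.) If `O` meets the
boundary of `M`, then `f` need not vanish there. -/
structure IsTestFunction (S : LRStructure d M) (O : Set M) (f : M → ℝ) : Prop where
  lipschitz : ∀ α, LocallyLipschitzOn (S.chart α).target (f ∘ (S.chart α).symm)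
  compactSupport : HasCompactSupport f
  support_subset : tsupport f ⊆ O

/-- The squared pointwise norm `|df|²` of the differential, computed in the charts around `p`
(all of them give the same value for almost every `p`). -/
def gradSq (S : LRStructure d M) (f : M → ℝ) (p : M) : ℝ≥0∞ :=
  ⨆ (α : S.A) (_ : p ∈ (S.chart α).source), ENNReal.ofReal
    (conormSq (S.g α (S.chart α p)) (dCoeff (f ∘ (S.chart α).symm) (S.chart α p)))

variable [MeasurableSpace M]

/-- `∫ |df|² dvol`. -/
def energy (S : LRStructure d M) (f : M → ℝ) : ℝ≥0∞ := ∫⁻ p, S.gradSq f p ∂S.vol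

/-- `∫ f² dvol`. -/
def normSq (S : LRStructure d M) (f : M → ℝ) : ℝ≥0∞ := ∫⁻ p, ENNReal.ofReal (f p ^ 2) ∂S.vol

/-- The first eigenvalue (bottom of the spectrum) of the Dirichlet Laplacian on the open set `O`,
given by the Rayleigh quotient. -/
def lambda1 (S : LRStructure d M) (O : Set M) : ℝ≥0∞ :=
  ⨅ (f : M → ℝ) (_ : S.IsTestFunction O f ∧ S.normSq f ≠ 0 ∧ S.normSq f ≠ ∞),
    S.energy f / S.normSq f

end Dirichlet

end LRStructure

end

end LRMfd

/-! The constant comes from a Faber–Krahn inequality in `ℝ^d` or the half-space, carried to the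
manifold through one almost Euclidean chart.

Euclidean part (`lintegral_sq_le_lintegral_fderiv_sq`): let `u` vanish off `S ⊆ C`, where `C` is the
whole space or the half-space, and let `B` be a half-ball of radius `ρ` whose vectors translate `C`
into itself. For `h ∈ B`, integrating along segments bounds the `L²` norm of `u(· + h) - u` over `C`
by `|h|` times that of the gradient. Expanding the square gives `∫ u² ≤ ρ² ∫ |∇u|² + 2 ∫ |u| |u(· +
h)|`. Averaged over `h ∈ B`, the last integral is at most `μ(S) / μ(B) · ∫ u²`, by translation
invariance and Cauchy–Schwarz. If `μ(B) ≥ 4 μ(S)`, half of `∫ u²` is absorbed, leaving `∫ u² ≤ 2 ρ²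
∫ |∇u|²`. Only inward translations occur, so no vanishing at the boundary is required.

Transfer: an open subset `O` of the ball lies in a chart where the metric is `b`-close to the
Euclidean one. There volumes are comparable up to `κ = b^{d/2}` (`smul_chartLebesgue_le_vol`,
`vol_restrict_le`), and squared Euclidean gradients are at most `b` times Riemannian ones
(`ae_enorm_fderiv_readInChart_sq_le`). Choosing `ρ^d` proportional to `vol O` yields the power
`-2/d`.

Since `ε₂ > 1`, a positive `R(x)` lies strictly below some admissible radius, which supplies both
the chart and relative compactness. -/

/-- The square of an integral over a set is at most the measure of the set times the integral of
the square. -/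
theorem sq_setLIntegral_le {α : Type*} [MeasurableSpace α] {μ : Measure α} (s : Set α)
    {F : α → ℝ≥0∞} (hF : AEMeasurable F (μ.restrict s)) :
    (∫⁻ x in s, F x ∂μ) ^ 2 ≤ μ s * ∫⁻ x in s, F x ^ 2 ∂μ := by
  have h := ENNReal.lintegral_mul_le_Lp_mul_Lq (μ.restrict s) Real.HolderConjugate.two_two
    (aemeasurable_const (b := (1 : ℝ≥0∞))) hF
  have h2 := pow_le_pow_left₀ (zero_le) h 2
  simp only [Pi.mul_apply, one_mul, ENNReal.one_rpow, lintegral_const, Measure.restrict_apply_univ,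
    mul_pow] at h2
  have e : ∀ y : ℝ≥0∞, (y ^ (1 / (2 : ℝ))) ^ 2 = y := fun y => by
    rw [← ENNReal.rpow_natCast, ← ENNReal.rpow_mul]; norm_num
  rw [e, e] at h2
  simpa using h2

/-! ### Locally Lipschitz maps: Rademacher's theorem and null sets. -/

section LocallyLipschitz

variable {V F : Type*} [NormedAddCommGroup V] [NormedSpace ℝ V] [FiniteDimensional ℝ V]
  [MeasurableSpace V] [BorelSpace V] [NormedAddCommGroup F] [NormedSpace ℝ F]
  [FiniteDimensional ℝ F] {μ : Measure V} [μ.IsAddHaarMeasure]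

/-- Rademacher's theorem for locally Lipschitz functions on a set. -/
theorem LocallyLipschitzOn.ae_differentiableWithinAt_of_mem {s : Set V} {f : V → F}
    (hf : LocallyLipschitzOn s f) : ∀ᵐ x ∂μ, x ∈ s → DifferentiableWithinAt ℝ f s x := by
  have : ProperSpace V := FiniteDimensional.proper ℝ V
  choose! K t ht hK using fun x (hx : x ∈ s) => hf hx
  -- Adding `sᶜ` turns the relative neighbourhood `t x` into a genuine one. Taking the interior
  -- makes `t x` a neighbourhood within `s` of every covered point of `s`, so differentiability
  -- within `t x` passes to `s`.
  obtain ⟨c, hcs, hc, hcover⟩ := TopologicalSpace.countable_cover_nhdsWithin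
    (f := fun x => interior (insert x (t x) ∪ sᶜ)) (s := s) (fun x hx => by
      have h1 : t x ∪ sᶜ ∈ nhds x := by
        obtain ⟨w, hw, hw2⟩ := mem_nhdsWithin_iff_exists_mem_nhds_inter.1 (ht x hx)
        filter_upwards [hw] with y hy
        by_cases hys : y ∈ s
        · exact Or.inl (hw2 ⟨hy, hys⟩)
        · exact Or.inr hys
      exact mem_nhdsWithin_of_mem_nhds (interior_mem_nhds.2
        (Filter.mem_of_superset h1 (union_subset_union_left _ (subset_insert _ _)))))
  have key : ∀ x ∈ c, ∀ᵐ y ∂μ, y ∈ t x → DifferentiableWithinAt ℝ f (t x) y := fun x hx =>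
    (hK x (hcs hx)).ae_differentiableWithinAt_of_mem
  filter_upwards [(ae_ball_iff hc).2 key] with y hy hys
  obtain ⟨x, hx, hyx⟩ := mem_iUnion₂.1 (hcover hys)
  have hxt : x ∈ t x := mem_of_mem_nhdsWithin (hcs hx) (ht x (hcs hx))
  rw [insert_eq_of_mem hxt] at hyx
  have hyt : y ∈ t x := (interior_subset hyx).resolve_right (fun h => h hys)
  refine (hy x hx hyt).mono_of_mem_nhdsWithin ?_
  filter_upwards [mem_nhdsWithin_of_mem_nhds (mem_interior_iff_mem_nhds.1 hyx),
    self_mem_nhdsWithin] with z hz hzs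
  exact hz.resolve_right (fun h => h hzs)

/-- Locally Lipschitz maps preserve null sets. -/
theorem LocallyLipschitzOn.measure_image_eq_zero {s t : Set V} {f : V → V}
    (hf : LocallyLipschitzOn s f) (hts : t ⊆ s) (ht : μ t = 0) : μ (f '' t) = 0 := by
  have : ProperSpace V := FiniteDimensional.proper ℝ V
  choose! K w hw hK using fun x (hx : x ∈ t) => (hf.mono hts) hx
  obtain ⟨c, hct, hc, hcover⟩ := TopologicalSpace.countable_cover_nhdsWithin hw
  have hle : f '' t ⊆ ⋃ x ∈ c, f '' (w x ∩ t) := by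
    rintro _ ⟨y, hy, rfl⟩
    obtain ⟨x, hx, hyx⟩ := mem_iUnion₂.1 (hcover hy)
    exact mem_iUnion₂.2 ⟨x, hx, mem_image_of_mem _ ⟨hyx, hy⟩⟩
  refine measure_mono_null hle ((measure_biUnion_null_iff hc).2 fun x hx => ?_)
  -- Lipschitz maps control Hausdorff measure, which in the top dimension has the same null sets as
  -- `μ`.
  set H : Measure V := Measure.hausdorffMeasure (Module.finrank ℝ V)
  have h0 : H (w x ∩ t) = 0 :=
    Measure.absolutelyContinuous_isAddHaarMeasure H μ (measure_mono_null inter_subset_right ht)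
  have h1 := ((hK x (hct hx)).mono (inter_subset_left (t := t))).hausdorffMeasure_image_le
    (d := Module.finrank ℝ V) (by positivity)
  rw [h0, mul_zero, nonpos_iff_eq_zero] at h1
  exact Measure.absolutelyContinuous_isAddHaarMeasure μ H h1

end LocallyLipschitz

/-! ### The Faber–Krahn inequality by averaging over translations. -/

section FaberKrahn

variable {V : Type*} [NormedAddCommGroup V] [NormedSpace ℝ V] [MeasurableSpace V] [BorelSpace V]

/-- The increment of a locally Lipschitz function along a segment on which it is almost everywhere
differentiable. -/
theorem enorm_sub_sq_le_lintegral_fderiv {C : Set V} {u : V → ℝ} (hu : LocallyLipschitzOn C u)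
    {x h : V} (hx : ∀ t ∈ Icc (0 : ℝ) 1, x + t • h ∈ C)
    (hd : ∀ᵐ t : ℝ, t ∈ Icc (0 : ℝ) 1 → DifferentiableAt ℝ u (x + t • h)) :
    ‖u (x + h) - u x‖ₑ ^ 2 ≤ ‖h‖ₑ ^ 2 * ∫⁻ t in Icc (0 : ℝ) 1, ‖fderiv ℝ u (x + t • h)‖ₑ ^ 2 := by
  set γ : ℝ → V := fun t => x + t • h with hγ
  have hlip : LipschitzWith ‖h‖₊ γ := LipschitzWith.of_dist_le_mul fun s t => by
    simp [hγ, dist_eq_norm, ← sub_smul, norm_smul, mul_comm]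
  have hloc : LocallyLipschitzOn (Icc (0 : ℝ) 1) (u ∘ γ) := fun t ht => by
    obtain ⟨K, w, hw, hK⟩ := hu (hx t ht)
    refine ⟨K * ‖h‖₊, γ ⁻¹' w, ?_, hK.comp hlip.lipschitzOnWith fun _ hy => hy⟩
    exact (hlip.continuous.continuousWithinAt.tendsto_nhdsWithin (s := Icc 0 1) (t := C) hx) hw
  -- By compactness of the segment, `u ∘ γ` is Lipschitz, hence absolutely continuous, and the
  -- fundamental theorem of calculus applies.
  obtain ⟨K, hK⟩ := hloc.exists_lipschitzOnWith_of_compact isCompact_Icc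
  rw [← uIcc_of_le zero_le_one] at hK
  have hFTC := hK.absolutelyContinuousOnInterval.integral_deriv_eq_sub
  have hle : ‖u (x + h) - u x‖ₑ ≤ ∫⁻ t in Icc (0 : ℝ) 1, ‖h‖ₑ * ‖fderiv ℝ u (γ t)‖ₑ := by
    have e : u (x + h) - u x = (u ∘ γ) 1 - (u ∘ γ) 0 := by simp [hγ]
    rw [e, ← hFTC, intervalIntegral.integral_of_le zero_le_one, ← integral_Icc_eq_integral_Ioc]
    refine (enorm_integral_le_lintegral_enorm _).trans (lintegral_mono_ae ?_)
    rw [ae_restrict_iff' measurableSet_Icc]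
    filter_upwards [hd] with t ht htI
    have h1 : HasDerivAt γ h t := by
      simpa [hγ] using ((hasDerivAt_id t).smul_const h).const_add x
    rw [((ht htI).hasFDerivAt.comp_hasDerivAt t h1).deriv, mul_comm]
    exact ContinuousLinearMap.le_opENorm _ _
  have hm : Measurable fun t => ‖fderiv ℝ u (γ t)‖ₑ :=
    ((measurable_fderiv ℝ u).comp hlip.continuous.measurable).enorm
  calc ‖u (x + h) - u x‖ₑ ^ 2
      ≤ (∫⁻ t in Icc (0 : ℝ) 1, ‖h‖ₑ * ‖fderiv ℝ u (γ t)‖ₑ) ^ 2 := by gcongr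
    _ ≤ volume (Icc (0 : ℝ) 1) * ∫⁻ t in Icc (0 : ℝ) 1, (‖h‖ₑ * ‖fderiv ℝ u (γ t)‖ₑ) ^ 2 :=
        sq_setLIntegral_le _ (hm.const_mul _).aemeasurable
    _ = _ := by simp only [mul_pow, lintegral_const_mul _ (hm.pow_const 2)]; simp [hγ]

variable [FiniteDimensional ℝ V] {μ : Measure V} [μ.IsAddHaarMeasure]

/-- Translation estimate in `L²` for a locally Lipschitz function on a set which is invariant
under the translations by `t • h`, `0 ≤ t ≤ 1`. -/
theorem lintegral_enorm_translate_sub_sq_le {C : Set V} (hC : MeasurableSet C)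
    (hint : ∀ᵐ x ∂μ, x ∈ C → C ∈ nhds x) {u : V → ℝ} (hu : LocallyLipschitzOn C u) {h : V}
    (hCh : ∀ x ∈ C, ∀ t ∈ Icc (0 : ℝ) 1, x + t • h ∈ C) :
    ∫⁻ x in C, ‖u (x + h) - u x‖ₑ ^ 2 ∂μ ≤ ‖h‖ₑ ^ 2 * ∫⁻ x in C, ‖fderiv ℝ u x‖ₑ ^ 2 ∂μ := by
  have hdiff : ∀ᵐ x ∂μ, x ∈ C → DifferentiableAt ℝ u x := by
    filter_upwards [hint, hu.ae_differentiableWithinAt_of_mem (μ := μ)] with x h1 h2 hx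
    exact (h2 hx).differentiableAt (h1 hx)
  have hmeas : MeasurableSet {x | x ∈ C → DifferentiableAt ℝ u x} := by
    have := hC.compl.union (measurableSet_of_differentiableAt ℝ u)
    convert this using 1
    ext x; simp [imp_iff_not_or]
  have hcont : Measurable fun p : V × ℝ => p.1 + p.2 • h := by fun_prop
  -- Fubini: for each fixed `t` the exceptional set is a translate of a null set, so almost every
  -- segment in direction `h` meets the bad points only at a null set of times.
  have hae : ∀ᵐ x ∂μ, ∀ᵐ t : ℝ, x + t • h ∈ C → DifferentiableAt ℝ u (x + t • h) := by
    rw [Measure.ae_ae_comm (p := fun x (t : ℝ) => x + t • h ∈ C → DifferentiableAt ℝ u (x + t • h))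
      (hcont hmeas)]
    refine .of_forall fun t => ?_
    exact (measurePreserving_add_right μ (t • h)).quasiMeasurePreserving.ae hdiff
  have hm : Measurable fun x => ‖fderiv ℝ u x‖ₑ ^ 2 := (measurable_fderiv ℝ u).enorm.pow_const 2
  calc ∫⁻ x in C, ‖u (x + h) - u x‖ₑ ^ 2 ∂μ
      ≤ ∫⁻ x in C, ‖h‖ₑ ^ 2 * (∫⁻ t in Icc (0 : ℝ) 1, ‖fderiv ℝ u (x + t • h)‖ₑ ^ 2) ∂μ := by
        refine lintegral_mono_ae ?_
        rw [ae_restrict_iff' hC]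
        filter_upwards [hae] with x hx hxC
        refine enorm_sub_sq_le_lintegral_fderiv hu (hCh x hxC) ?_
        filter_upwards [hx] with t ht htI using ht (hCh x hxC t htI)
    _ = ‖h‖ₑ ^ 2 * ∫⁻ t in Icc (0 : ℝ) 1, (∫⁻ x in C, ‖fderiv ℝ u (x + t • h)‖ₑ ^ 2 ∂μ) := by
        rw [lintegral_const_mul', lintegral_lintegral_swap]
        · exact (hm.comp hcont).aemeasurable
        · finiteness
    _ ≤ ‖h‖ₑ ^ 2 * ∫⁻ _ in Icc (0 : ℝ) 1, (∫⁻ x in C, ‖fderiv ℝ u x‖ₑ ^ 2 ∂μ) := by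
        refine mul_le_mul_right ?_ _
        -- Translating by `t • h` moves `C` into itself, so each inner integral is at most the full
        -- one.
        refine setLIntegral_mono' measurableSet_Icc fun t ht => ?_
        have hmp := measurePreserving_add_right μ (t • h)
        rw [← (hmp.restrict_preimage hC).lintegral_comp hm]
        exact lintegral_mono_set fun x hx => hCh x hx t ht
    _ = _ := by simp

/-- A Faber–Krahn inequality on a set which is invariant under the translations by the vectors of
a star-shaped set `B` of large volume. -/
theorem lintegral_sq_le_lintegral_fderiv_sq {C B S : Set V} (hC : MeasurableSet C)
    (hint : ∀ᵐ x ∂μ, x ∈ C → C ∈ nhds x) {u : V → ℝ} (hu : LocallyLipschitzOn C u)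
    (hum : Measurable u) (hB : MeasurableSet B)
    (hCB : ∀ x ∈ C, ∀ h ∈ B, ∀ t ∈ Icc (0 : ℝ) 1, x + t • h ∈ C) {ρ : ℝ≥0∞}
    (hBρ : ∀ h ∈ B, ‖h‖ₑ ≤ ρ) (hSC : S ⊆ C) (huS : ∀ x ∉ S, u x = 0)
    (hvol : 4 * μ S ≤ μ B) (hB0 : μ B ≠ 0) (hBfin : μ B ≠ ∞)
    (hfin : ∫⁻ x in C, ‖u x‖ₑ ^ 2 ∂μ ≠ ∞) :
    ∫⁻ x in C, ‖u x‖ₑ ^ 2 ∂μ ≤ 2 * ρ ^ 2 * ∫⁻ x in C, ‖fderiv ℝ u x‖ₑ ^ 2 ∂μ := by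
  set I := ∫⁻ x in C, ‖u x‖ₑ ^ 2 ∂μ with hI
  set D := ∫⁻ x in C, ‖fderiv ℝ u x‖ₑ ^ 2 ∂μ with hD
  have hue := hum.enorm
  -- This is `a² = (c - a)² + 2ac - c²` with the last term dropped.
  have hpt : ∀ a c : ℝ, ‖a‖ₑ ^ 2 ≤ ‖c - a‖ₑ ^ 2 + 2 * (‖a‖ₑ * ‖c‖ₑ) := fun a c => by
    simp only [← ofReal_norm, Real.norm_eq_abs]
    rw [← ENNReal.ofReal_pow (abs_nonneg _), ← ENNReal.ofReal_pow (abs_nonneg _),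
      ← ENNReal.ofReal_mul (abs_nonneg _), ← ENNReal.ofReal_ofNat 2,
      ← ENNReal.ofReal_mul (by norm_num), ← ENNReal.ofReal_add (by positivity) (by positivity)]
    refine ENNReal.ofReal_le_ofReal ?_
    rw [sq_abs, sq_abs, ← abs_mul]
    nlinarith [le_abs_self (a * c), sq_nonneg c]
  have hstep : ∀ h ∈ B, I ≤ ρ ^ 2 * D + 2 * ∫⁻ x in C, ‖u x‖ₑ * ‖u (x + h)‖ₑ ∂μ := fun h hh => by
    have hm2 : Measurable fun x => ‖u x‖ₑ * ‖u (x + h)‖ₑ :=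
      hue.mul (hue.comp (measurable_add_const h))
    calc I ≤ ∫⁻ x in C, (‖u (x + h) - u x‖ₑ ^ 2 + 2 * (‖u x‖ₑ * ‖u (x + h)‖ₑ)) ∂μ :=
          lintegral_mono fun x => hpt _ _
      _ = ∫⁻ x in C, ‖u (x + h) - u x‖ₑ ^ 2 ∂μ + 2 * ∫⁻ x in C, ‖u x‖ₑ * ‖u (x + h)‖ₑ ∂μ := by
          rw [lintegral_add_right _ (hm2.const_mul 2), lintegral_const_mul _ hm2]
      _ ≤ _ := by
          gcongr
          refine (lintegral_enorm_translate_sub_sq_le hC hint hu fun x hx => hCB x hx h hh).trans ?_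
          gcongr
          exact hBρ h hh
  have hzero : ∀ x, u x ≠ 0 → x ∈ S := fun x hx => by_contra fun h => hx (huS x h)
  have hsupp : ∀ s : Set V, S ⊆ s → ∫⁻ x in s, ‖u x‖ₑ ∂μ = ∫⁻ x, ‖u x‖ₑ ∂μ := fun s hs =>
    setLIntegral_eq_of_support_subset fun x hx => hs (hzero x (by simpa using hx))
  have hI' : I = ∫⁻ x in S, ‖u x‖ₑ ^ 2 ∂μ := by
    rw [hI, setLIntegral_eq_of_support_subset, setLIntegral_eq_of_support_subset]
    · exact fun x hx => hzero x (by simpa using hx)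
    · exact fun x hx => hSC (hzero x (by simpa using hx))
  -- For fixed `x`, translation invariance bounds `∫_B |u(x + h)| dh` by `∫ |u|`. The double
  -- integral is thus at most `(∫_S |u|)²`, to which Cauchy–Schwarz applies on `S`.
  have hcross : ∫⁻ h in B, ∫⁻ x in C, ‖u x‖ₑ * ‖u (x + h)‖ₑ ∂μ ∂μ ≤ μ S * I := by
    rw [lintegral_lintegral_swap]
    · calc ∫⁻ x in C, ∫⁻ h in B, ‖u x‖ₑ * ‖u (x + h)‖ₑ ∂μ ∂μ
          ≤ ∫⁻ x in C, ‖u x‖ₑ * ∫⁻ y in S, ‖u y‖ₑ ∂μ ∂μ := by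
            refine lintegral_mono fun x => ?_
            rw [lintegral_const_mul' _ _ (by finiteness)]
            rw [hsupp S le_rfl, ← lintegral_add_left_eq_self (fun y => ‖u y‖ₑ) x]
            exact mul_le_mul_right (setLIntegral_le_lintegral _ _) _
        _ = (∫⁻ y in S, ‖u y‖ₑ ∂μ) ^ 2 := by
            rw [lintegral_mul_const _ hue, hsupp C hSC, hsupp S le_rfl, sq]
        _ ≤ _ := by
            rw [hI']
            exact sq_setLIntegral_le _ hue.aemeasurable
    · exact (Measurable.mul (hue.comp measurable_snd)
        (hue.comp (measurable_snd.add measurable_fst))).aemeasurable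
  have hmain : μ B * I ≤ μ B * (ρ ^ 2 * D) + 2 * (μ S * I) := by
    have hm : Measurable fun h => ∫⁻ x in C, ‖u x‖ₑ * ‖u (x + h)‖ₑ ∂μ := by
      exact Measurable.lintegral_prod_right' (f := fun p : V × V => ‖u p.2‖ₑ * ‖u (p.2 + p.1)‖ₑ) <|
        (hue.comp measurable_snd).mul (hue.comp (measurable_snd.add measurable_fst))
    calc μ B * I = ∫⁻ _ in B, I ∂μ := by simp [mul_comm]
      _ ≤ ∫⁻ h in B, (ρ ^ 2 * D + 2 * ∫⁻ x in C, ‖u x‖ₑ * ‖u (x + h)‖ₑ ∂μ) ∂μ :=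
          setLIntegral_mono' hB hstep
      _ = μ B * (ρ ^ 2 * D) + 2 * ∫⁻ h in B, ∫⁻ x in C, ‖u x‖ₑ * ‖u (x + h)‖ₑ ∂μ ∂μ := by
          rw [lintegral_add_left measurable_const, lintegral_const_mul _ hm]
          simp [mul_comm]
      _ ≤ _ := by gcongr
  have h4 : 4 * (μ S * I) ≤ μ B * I := by rw [← mul_assoc]; gcongr
  have h5 : μ B * I ≤ μ B * (2 * ρ ^ 2 * D) := by
    have e1 : 2 * (μ B * I) ≤ 2 * (μ B * (ρ ^ 2 * D)) + μ B * I := by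
      calc 2 * (μ B * I) ≤ 2 * (μ B * (ρ ^ 2 * D) + 2 * (μ S * I)) := by gcongr
        _ = 2 * (μ B * (ρ ^ 2 * D)) + 4 * (μ S * I) := by ring
        _ ≤ _ := by gcongr
    rw [two_mul] at e1
    -- The absorption: cancelling `μ B * I` in `ℝ≥0∞` is legitimate only because it is finite.
    have e2 := (ENNReal.add_le_add_iff_right (ENNReal.mul_ne_top hBfin hfin)).1 e1
    exact e2.trans_eq (by ring)
  exact (ENNReal.mul_le_mul_iff_right hB0 hBfin).1 h5

end FaberKrahn

namespace LRMfd

/-! ### Forms, dual forms and change of variables. -/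

section LinearAlgebra

variable {d : ℕ}

/-- The pull-back of a positive definite form by `D` has determinant between `b⁻ᵈ` and `bᵈ` if its
values lie between `b⁻¹ ‖ξ‖²` and `b ‖ξ‖²`. -/
theorem sqrt_det_mul_abs_det_mem_Icc {G : Matrix (Fin d) (Fin d) ℝ} (hG : G.PosDef)
    (D : E d →L[ℝ] E d) {b : ℝ} (hb : 0 < b)
    (h : ∀ ξ, b⁻¹ * ‖ξ‖ ^ 2 ≤ form G (D ξ) (D ξ) ∧ form G (D ξ) (D ξ) ≤ b * ‖ξ‖ ^ 2) :
    √G.det * |D.det| ∈ Icc (√(b ^ d))⁻¹ √(b ^ d) := by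
  set e := (EuclideanSpace.basisFun (Fin d) ℝ).toBasis with he
  set A := LinearMap.toMatrix e e (D : E d →ₗ[ℝ] E d) with hA
  have hdetA : A.det = D.det := LinearMap.det_toMatrix e _
  have hAv : ∀ ξ : E d, (A *ᵥ fun i => ξ i) = fun i => D ξ i := fun ξ => by
    have := LinearMap.toMatrix_mulVec_repr e e (D : E d →ₗ[ℝ] E d) ξ
    have e1 : ∀ ζ : E d, ⇑(e.repr ζ) = fun i => ζ i := fun ζ => by ext i; simp [he]
    rw [e1, e1] at this
    exact this
  set P := Aᵀ * G * A with hP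
  have hPh : P.IsHermitian := by
    have := Matrix.isHermitian_conjTranspose_mul_mul A hG.isHermitian
    rwa [Matrix.conjTranspose_eq_transpose_of_trivial] at this
  have hform : ∀ ξ : E d, form G (D ξ) (D ξ) = (fun i => ξ i) ⬝ᵥ (P *ᵥ fun i => ξ i) := fun ξ => by
    rw [form, ← hAv, hP, ← Matrix.mulVec_mulVec, ← Matrix.mulVec_mulVec,
      Matrix.dotProduct_mulVec _ Aᵀ, Matrix.vecMul_transpose]
  -- Each eigenvalue of the pulled-back form is its value at a unit eigenvector, where the
  -- hypothesis applies.
  have hev : ∀ i, hPh.eigenvalues i ∈ Icc b⁻¹ b := fun i => by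
    have h1 := hPh.eigenvalues_eq i
    have h2 := h (hPh.eigenvectorBasis i)
    have h3 : hPh.eigenvalues i = form G (D (hPh.eigenvectorBasis i))
        (D (hPh.eigenvectorBasis i)) := by
      rw [h1, hform]; simp
    rw [← h3, hPh.eigenvectorBasis.orthonormal.1 i] at h2
    simpa using h2
  have hdetP : P.det = (√G.det * |D.det|) ^ 2 := by
    rw [hP, Matrix.det_mul, Matrix.det_mul, Matrix.det_transpose,
      hdetA, mul_pow, Real.sq_sqrt hG.det_pos.le, sq_abs]
    ring
  have hprod : P.det = ∏ i, hPh.eigenvalues i := by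
    simpa using hPh.det_eq_prod_eigenvalues
  have hlow : (b ^ d)⁻¹ ≤ P.det := by
    rw [hprod, ← inv_pow]
    calc b⁻¹ ^ d = ∏ _i : Fin d, b⁻¹ := by simp
      _ ≤ _ := Finset.prod_le_prod (fun _ _ => (inv_pos.2 hb).le) fun i _ => (hev i).1
  have hupp : P.det ≤ b ^ d := by
    rw [hprod]
    calc ∏ i, hPh.eigenvalues i ≤ ∏ _i : Fin d, b :=
          Finset.prod_le_prod (fun i _ => (inv_pos.2 hb).le.trans (hev i).1) fun i _ => (hev i).2
      _ = _ := by simp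
  have hpos : 0 ≤ √G.det * |D.det| := by positivity
  rw [hdetP] at hlow hupp
  refine ⟨?_, Real.le_sqrt_of_sq_le hupp⟩
  rw [← Real.sqrt_inv]
  exact (Real.sqrt_le_left hpos).2 hlow

/-- The Cauchy–Schwarz inequality between a form and its dual form. -/
theorem sq_dotProduct_le_conormSq_mul_form {G : Matrix (Fin d) (Fin d) ℝ} (hG : G.PosDef)
    (θ : Fin d → ℝ) (η : E d) :
    (θ ⬝ᵥ fun i => η i) ^ 2 ≤ conormSq G θ * form G η η := by
  set v : Fin d → ℝ := fun i => η i with hv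
  have hdet : IsUnit G.det := hG.det_pos.ne'.isUnit
  have hsymm : ∀ x y : Fin d → ℝ, x ⬝ᵥ (G *ᵥ y) = y ⬝ᵥ (G *ᵥ x) := fun x y => by
    have : Gᵀ = G := by
      simpa [Matrix.conjTranspose_eq_transpose_of_trivial] using hG.isHermitian.eq
    rw [Matrix.dotProduct_mulVec, ← Matrix.mulVec_transpose, this, dotProduct_comm]
  -- The vector representing the covector `θ` with respect to `G`; the claim becomes Cauchy–Schwarz
  -- for `w` and `v`.
  set w := G⁻¹ *ᵥ θ with hw
  have hGw : G *ᵥ w = θ := by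
    rw [hw, Matrix.mulVec_mulVec, Matrix.mul_nonsing_inv _ hdet, Matrix.one_mulVec]
  set Q := v ⬝ᵥ (G *ᵥ v) with hQ
  set c := θ ⬝ᵥ v with hc
  have hwv : w ⬝ᵥ (G *ᵥ v) = c := by rw [hsymm, hGw, dotProduct_comm]
  have hvw : v ⬝ᵥ (G *ᵥ w) = c := by rw [hGw, dotProduct_comm]
  have hww : w ⬝ᵥ (G *ᵥ w) = conormSq G θ := by rw [hGw, dotProduct_comm]; rfl
  change c ^ 2 ≤ conormSq G θ * Q
  by_cases hv0 : v = 0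
  · simp [hc, hQ, hv0]
  have hQpos : 0 < Q := by simpa using hG.dotProduct_mulVec_pos hv0
  -- Up to the factor `Q`, this vector is the component of `w` orthogonal to `v`; its squared length
  -- expands to `Q * (conormSq G θ * Q - c ^ 2)`.
  have h0 : 0 ≤ (Q • w - c • v) ⬝ᵥ (G *ᵥ (Q • w - c • v)) := by
    simpa using hG.posSemidef.dotProduct_mulVec_nonneg (Q • w - c • v)
  simp only [Matrix.mulVec_sub, Matrix.mulVec_smul, dotProduct_sub, sub_dotProduct,
    smul_dotProduct, dotProduct_smul, smul_eq_mul, hwv, hvw, hww, ← hQ] at h0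
  have h1 : 0 ≤ Q * (conormSq G θ * Q - c ^ 2) := by linarith
  linarith [nonneg_of_mul_nonneg_right h1 hQpos]

theorem conormSq_nonneg {G : Matrix (Fin d) (Fin d) ℝ} (hG : G.PosDef) (θ : Fin d → ℝ) :
    0 ≤ conormSq G θ := by
  simpa [conormSq] using hG.inv.posSemidef.dotProduct_mulVec_nonneg θ

theorem dotProduct_dCoeff (h : E d → ℝ) (z η : E d) :
    (dCoeff h z ⬝ᵥ fun i => η i) = fderiv ℝ h z η := by
  conv_rhs => rw [← (EuclideanSpace.basisFun (Fin d) ℝ).sum_repr η]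
  simp [dotProduct, dCoeff, mul_comm]

/-- The differential of `h ∘ T` is controlled by the co-metric if the pull-back of the metric by
`T` is controlled by the Euclidean metric. -/
theorem norm_fderiv_sq_le_conormSq {G : Matrix (Fin d) (Fin d) ℝ} (hG : G.PosDef) {b : ℝ}
    (hb : 0 ≤ b) {h u : E d → ℝ} {T : E d → E d} {z : E d}
    (hu : u =ᶠ[nhds z] h ∘ T) (hT : DifferentiableAt ℝ T z) (hh : DifferentiableAt ℝ h (T z))
    (hGT : ∀ ξ, form G (fderiv ℝ T z ξ) (fderiv ℝ T z ξ) ≤ b * ‖ξ‖ ^ 2) :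
    ‖fderiv ℝ u z‖ ^ 2 ≤ b * conormSq G (dCoeff h (T z)) := by
  have h0 := conormSq_nonneg hG (dCoeff h (T z))
  have hle : ‖fderiv ℝ u z‖ ≤ √(b * conormSq G (dCoeff h (T z))) := by
    refine ContinuousLinearMap.opNorm_le_bound _ (Real.sqrt_nonneg _) fun ξ => ?_
    rw [hu.fderiv_eq, fderiv_comp z hh hT, ContinuousLinearMap.comp_apply, ← dotProduct_dCoeff,
      ← Real.sqrt_sq (norm_nonneg ξ), ← Real.sqrt_mul (by positivity), Real.norm_eq_abs]
    refine Real.abs_le_sqrt ((sq_dotProduct_le_conormSq_mul_form hG _ _).trans ?_)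
    nlinarith [mul_le_mul_of_nonneg_left (hGT ξ) h0]
  calc _ ≤ (√(b * conormSq G (dCoeff h (T z)))) ^ 2 := by gcongr
    _ = _ := Real.sq_sqrt (by positivity)

/-- The frontier of a convex set is Lebesgue null. This is how the boundary of the half-space is
discarded, so that derivatives within a set are full derivatives almost everywhere. -/
theorem _root_.Convex.ae_mem_nhds_of_mem {C : Set (E d)} (hC : Convex ℝ C) :
    ∀ᵐ x : E d, x ∈ C → C ∈ nhds x := by
  have h : ∀ᵐ x : E d, x ∉ frontier C := measure_eq_zero_iff_ae_notMem.1 (hC.addHaar_frontier _)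
  filter_upwards [h] with x hx hxC
  by_contra hn
  exact hx ⟨subset_closure hxC, fun hi => hn (mem_interior_iff_mem_nhds.1 hi)⟩

/-- Change of variables for the Riemannian volume: if the pull-back of the metric `G` by `T` is
controlled by the Euclidean metric, then so is the volume. -/
theorem lintegral_sqrt_det_image_mem_Icc {Z : Set (E d)} (hZ : MeasurableSet Z) {T : E d → E d}
    (hT : LocallyLipschitzOn Z T) (hinj : InjOn T Z)
    (hdiff : ∀ᵐ z, z ∈ Z → DifferentiableAt ℝ T z)
    {G : E d → Matrix (Fin d) (Fin d) ℝ} (hG : ∀ z ∈ Z, (G (T z)).PosDef) {b : ℝ} (hb : 0 < b)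
    (h : ∀ᵐ z, z ∈ Z → ∀ ξ : E d,
      b⁻¹ * ‖ξ‖ ^ 2 ≤ form (G (T z)) (fderiv ℝ T z ξ) (fderiv ℝ T z ξ) ∧
      form (G (T z)) (fderiv ℝ T z ξ) (fderiv ℝ T z ξ) ≤ b * ‖ξ‖ ^ 2) :
    ∫⁻ w in T '' Z, ENNReal.ofReal √(G w).det ∈
      Icc (ENNReal.ofReal (√(b ^ d))⁻¹ * volume Z) (ENNReal.ofReal √(b ^ d) * volume Z) := by
  -- Points without a derivative or without the metric bounds go into a null set `N`. Its image is
  -- null because `T` is locally Lipschitz, so the area formula is needed only on `Z \ N`.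
  obtain ⟨N, hN, hNm, hN0⟩ := exists_measurable_superset_of_null
    (Filter.eventually_and.2 ⟨hdiff, h⟩ : _ ∈ ae volume)
  have hgood : ∀ z ∈ Z \ N, z ∈ Z ∧ _ := fun z hz =>
    ⟨hz.1, (not_not.1 fun hn => hz.2 (hN hn) : (z ∈ Z → _) ∧ (z ∈ Z → _))⟩
  have himg : T '' Z =ᵐ[volume] T '' (Z \ N) := by
    have h0 : volume (T '' (Z ∩ N)) = 0 :=
      hT.measure_image_eq_zero inter_subset_left (measure_mono_null inter_subset_right hN0)
    conv_lhs => rw [← sdiff_union_inter Z N, image_union]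
    exact union_ae_eq_left_of_ae_eq_empty (ae_eq_empty.2 h0)
  have hvol : volume Z = volume (Z \ N) := (measure_sdiff_null hN0).symm
  rw [setLIntegral_congr himg, lintegral_image_eq_lintegral_abs_det_fderiv_mul volume
    (hZ.diff hNm) (f' := fderiv ℝ T)
    (fun z hz => ((hgood z hz).2.1 hz.1).hasFDerivAt.hasFDerivWithinAt) (hinj.mono sdiff_subset),
    hvol]
  have hpt : ∀ z ∈ Z \ N, √(G (T z)).det * |(fderiv ℝ T z).det| ∈ Icc (√(b ^ d))⁻¹ √(b ^ d) :=
    fun z hz => sqrt_det_mul_abs_det_mem_Icc (hG z hz.1) _ hb ((hgood z hz).2.2 hz.1)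
  constructor
  · rw [← setLIntegral_const]
    refine setLIntegral_mono' (hZ.diff hNm) fun z hz => ?_
    rw [← ENNReal.ofReal_mul (abs_nonneg _), mul_comm]
    exact ENNReal.ofReal_le_ofReal (hpt z hz).1
  · rw [← setLIntegral_const]
    refine setLIntegral_mono' (hZ.diff hNm) fun z hz => ?_
    rw [← ENNReal.ofReal_mul (abs_nonneg _), mul_comm]
    exact ENNReal.ofReal_le_ofReal (hpt z hz).2

end LinearAlgebra

/-! ### Model open sets and the Euclidean inequality on them. -/

section ModelSpace

open scoped Pointwise

variable {d : ℕ} [NeZero d]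

theorem isClosed_halfSpace : IsClosed (halfSpace d) :=
  isClosed_le continuous_const (by fun_prop)

theorem convex_halfSpace : Convex ℝ (halfSpace d) := fun x hx y hy s t hs ht _ => by
  simp only [halfSpace, mem_ofPred_eq] at *
  simp; positivity

theorem add_smul_mem_halfSpace {x h : E d} (hx : x ∈ halfSpace d) (hh : h ∈ halfSpace d) {t : ℝ}
    (ht : 0 ≤ t) : x + t • h ∈ halfSpace d := by
  simp only [halfSpace, mem_ofPred_eq] at *
  simp; positivity

/-- A model open set is relatively open in a closed convex set invariant under translations by
vectors of the half-space. -/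
theorem IsModelOpen.exists_eq_inter {V : Set (E d)} (hV : IsModelOpen V) :
    ∃ C W : Set (E d), IsClosed C ∧ Convex ℝ C ∧ IsOpen W ∧ V = W ∩ C ∧
      ∀ x ∈ C, ∀ h ∈ halfSpace d, ∀ t : ℝ, 0 ≤ t → x + t • h ∈ C := by
  rcases hV with hV | ⟨W, hW, rfl⟩
  · exact ⟨univ, V, isClosed_univ, convex_univ, hV, by simp, by simp⟩
  · exact ⟨halfSpace d, W, isClosed_halfSpace, convex_halfSpace, hW, rfl,
      fun x hx h hh t ht => add_smul_mem_halfSpace hx hh ht⟩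

theorem IsModelOpen.inter {V U : Set (E d)} (hV : IsModelOpen V) (hU : IsOpen U) :
    IsModelOpen (U ∩ V) := by
  rcases hV with hV | ⟨W, hW, rfl⟩
  · exact Or.inl (hU.inter hV)
  · exact Or.inr ⟨U ∩ W, hU.inter hW, by rw [inter_assoc]⟩

theorem IsModelOpen.measurableSet {V : Set (E d)} (hV : IsModelOpen V) : MeasurableSet V := by
  obtain ⟨C, W, hC, -, hW, rfl, -⟩ := hV.exists_eq_inter
  exact hW.measurableSet.inter hC.measurableSet

theorem IsModelOpen.ae_mem_nhds_of_mem {V : Set (E d)} (hV : IsModelOpen V) :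
    ∀ᵐ x : E d, x ∈ V → V ∈ nhds x := by
  obtain ⟨C, W, -, hC, hW, rfl, -⟩ := hV.exists_eq_inter
  filter_upwards [hC.ae_mem_nhds_of_mem] with x hx hxV
  exact Filter.inter_mem (hW.mem_nhds hxV.1) (hx hxV.2)

theorem IsModelOpen.ae_differentiableAt {F : Type*} [NormedAddCommGroup F] [NormedSpace ℝ F]
    [FiniteDimensional ℝ F] {V : Set (E d)} (hV : IsModelOpen V) {f : E d → F}
    (hf : LocallyLipschitzOn V f) : ∀ᵐ x : E d, x ∈ V → DifferentiableAt ℝ f x := by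
  filter_upwards [hV.ae_mem_nhds_of_mem, hf.ae_differentiableWithinAt_of_mem (μ := volume)]
    with x h1 h2 hx
  exact (h2 hx).differentiableAt (h1 hx)

/-- The volume of the unit half-ball. -/
noncomputable def halfBallVolume (d : ℕ) [NeZero d] : ℝ≥0∞ :=
  volume (Metric.closedBall (0 : E d) 1 ∩ halfSpace d)

theorem halfBallVolume_ne_top : halfBallVolume d ≠ ∞ :=
  measure_ne_top_of_subset inter_subset_left (isCompact_closedBall _ _).measure_ne_top

theorem halfBallVolume_ne_zero : halfBallVolume d ≠ 0 := by
  have hopen : IsOpen (Metric.ball (0 : E d) 1 ∩ {z | 0 < z (Fin.rev 0)}) :=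
    Metric.isOpen_ball.inter (isOpen_lt continuous_const (by fun_prop))
  have hne : (Metric.ball (0 : E d) 1 ∩ {z | 0 < z (Fin.rev 0)}).Nonempty :=
    ⟨EuclideanSpace.single (Fin.rev 0) (1 / 2), by
      simp only [mem_inter_iff, Metric.mem_ball, dist_zero_right, mem_ofPred_eq,
        PiLp.norm_single]
      norm_num⟩
  refine ((hopen.measure_pos volume hne).trans_le (measure_mono ?_)).ne'
  exact inter_subset_inter Metric.ball_subset_closedBall fun z hz => le_of_lt (α := ℝ) hz

/-- The Faber–Krahn inequality for compactly supported Lipschitz functions in a model open set. -/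
theorem IsModelOpen.lintegral_sq_le {V K : Set (E d)} (hV : IsModelOpen V) {u : E d → ℝ}
    (hu : LocallyLipschitzOn V u) (hK : IsCompact K) (hKV : K ⊆ V) (huK : ∀ z ∉ K, u z = 0)
    {ρ : ℝ} (hρ : 0 < ρ) (hvol : 4 * volume V ≤ ENNReal.ofReal (ρ ^ d) * halfBallVolume d)
    (hfin : ∫⁻ z in V, ‖u z‖ₑ ^ 2 ≠ ∞) :
    ∫⁻ z in V, ‖u z‖ₑ ^ 2 ≤
      2 * ENNReal.ofReal ρ ^ 2 * ∫⁻ z in V, ‖fderiv ℝ u z‖ₑ ^ 2 := by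
  obtain ⟨C, W, hCc, hC, hW, rfl, htr⟩ := hV.exists_eq_inter
  have hzero : ∀ z, u z ≠ 0 → z ∈ K := fun z hz => by_contra fun h => hz (huK z h)
  have hloc : ∀ z ∉ K, u =ᶠ[nhds z] fun _ => 0 := fun z hz => by
    filter_upwards [hK.isClosed.isOpen_compl.mem_nhds hz] with y hy using huK y hy
  -- Since `u` vanishes near every point off the compact set `K`, it is locally Lipschitz on all of
  -- `C`, which, unlike `V`, is invariant under the translations.
  have huC : LocallyLipschitzOn C u := fun z hz => by
    by_cases hzK : z ∈ K
    · obtain ⟨L, t, ht, hL⟩ := hu (hKV hzK)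
      refine ⟨L, t, ?_, hL⟩
      rwa [inter_comm, nhdsWithin_inter_of_mem' (mem_nhdsWithin_of_mem_nhds
        (hW.mem_nhds (hKV hzK).1))] at ht
    · refine ⟨0, Kᶜ, mem_nhdsWithin_of_mem_nhds (hK.isClosed.isOpen_compl.mem_nhds hzK), ?_⟩
      exact (LipschitzOnWith.of_dist_le_mul fun x hx y hy => by simp [huK x hx, huK y hy])
  have hum : Measurable u := by
    classical
    have h1 : u = K.piecewise u fun _ => 0 := by
      ext z
      by_cases hz : z ∈ K
      · simp [hz]
      · simp [hz, huK z hz]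
    rw [h1]
    exact (hu.continuousOn.mono hKV).measurable_piecewise continuousOn_const
      hK.isClosed.measurableSet
  have e1 : ∀ s, K ⊆ s → ∫⁻ z in s, ‖u z‖ₑ ^ 2 = ∫⁻ z, ‖u z‖ₑ ^ 2 := fun s hs =>
    setLIntegral_eq_of_support_subset fun z hz => hs (hzero z (by simpa using hz))
  have e2 : ∀ s, K ⊆ s → ∫⁻ z in s, ‖fderiv ℝ u z‖ₑ ^ 2 = ∫⁻ z, ‖fderiv ℝ u z‖ₑ ^ 2 :=
    fun s hs => setLIntegral_eq_of_support_subset fun z hz => hs <| by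
      by_contra h
      have h0 : fderiv ℝ u z = 0 := by rw [(hloc z h).fderiv_eq, fderiv_fun_const]; rfl
      have h1 : ‖fderiv ℝ u z‖ₑ = 0 := by
        rw [← ofReal_norm, h0, norm_zero, ENNReal.ofReal_zero]
      exact hz (by simp [h1])
  have hKC : K ⊆ C := hKV.trans inter_subset_right
  -- All integrands are supported in `K`, so `V` may be replaced by `C`.
  rw [e1 _ hKV, ← e1 C hKC] at hfin ⊢
  rw [e2 _ hKV, ← e2 C hKC]
  have hBvol : volume (ρ • (Metric.closedBall (0 : E d) 1 ∩ halfSpace d)) =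
      ENNReal.ofReal (ρ ^ d) * halfBallVolume d := by
    rw [Measure.addHaar_smul_of_nonneg _ hρ.le, finrank_euclideanSpace_fin]
    rfl
  refine lintegral_sq_le_lintegral_fderiv_sq
    (B := ρ • (Metric.closedBall (0 : E d) 1 ∩ halfSpace d)) (S := W ∩ C)
    hCc.measurableSet hC.ae_mem_nhds_of_mem huC hum ?_ ?_ ?_ inter_subset_right
    (fun x hx => huK x fun h => hx (hKV h)) ?_ ?_ ?_ hfin
  · exact (((isCompact_closedBall _ _).inter_right isClosed_halfSpace).smul ρ).measurableSet
  · rintro x hx _ ⟨h, hh, rfl⟩ t ht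
    simp only [smul_smul]
    exact htr x hx h hh.2 _ (mul_nonneg ht.1 hρ.le)
  · rintro _ ⟨h, hh, rfl⟩
    simp only
    rw [← ofReal_norm, norm_smul, Real.norm_of_nonneg hρ.le]
    exact ENNReal.ofReal_le_ofReal (mul_le_of_le_one_right hρ.le (by simpa using hh.1))
  · rwa [hBvol]
  · rw [hBvol]
    exact mul_ne_zero (by simpa using pow_pos hρ d) halfBallVolume_ne_zero
  · rw [hBvol]
    exact ENNReal.mul_ne_top ENNReal.ofReal_ne_top halfBallVolume_ne_top

end ModelSpace

end LRMfd

/-! ### Maps on subsets, and images under charts. -/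

theorem ContinuousOn.measurableSet_inter_preimage {X Y : Type*} [TopologicalSpace X]
    [MeasurableSpace X] [OpensMeasurableSpace X] [TopologicalSpace Y] [MeasurableSpace Y]
    [BorelSpace Y] {f : X → Y} {t : Set X} (hf : ContinuousOn f t) (ht : MeasurableSet t)
    {s : Set Y} (hs : MeasurableSet s) : MeasurableSet (t ∩ f ⁻¹' s) := by
  rw [← Subtype.image_preimage_coe]
  exact ht.subtype_image ((continuousOn_iff_continuous_domRestrict.1 hf).measurable hs)

theorem LocallyLipschitzOn.comp {X Y Z : Type*} [PseudoEMetricSpace X] [PseudoEMetricSpace Y]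
    [PseudoEMetricSpace Z] {g : Y → Z} {f : X → Y} {t : Set Y} {s : Set X}
    (hg : LocallyLipschitzOn t g) (hf : LocallyLipschitzOn s f) (hst : MapsTo f s t) :
    LocallyLipschitzOn s (g ∘ f) := fun x hx => by
  obtain ⟨K, v, hv, hK⟩ := hg (hst hx)
  obtain ⟨L, w, hw, hL⟩ := hf hx
  refine ⟨K * L, w ∩ f ⁻¹' v, Filter.inter_mem hw ?_, ?_⟩
  · exact ((hf.continuousOn x hx).tendsto_nhdsWithin hst) hv
  · exact hK.comp (hL.mono inter_subset_left) fun y hy => hy.2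

namespace LRMfd

section Charts

variable {d : ℕ} [NeZero d] {M : Type u} [TopologicalSpace M]

theorem IsChart.image_eq {φ : PartialEquiv M (E d)} (hφ : IsChart φ) {O : Set M} (hO : IsOpen O)
    (hOφ : O ⊆ φ.source) : ∃ U, IsOpen U ∧ φ '' O = U ∩ φ.target := by
  obtain ⟨U, hU, hU2⟩ := continuousOn_iff'.1 hφ.continuousOn_symm O hO
  refine ⟨U, hU, ?_⟩
  rw [← hU2, inter_comm, ← φ.image_source_inter_eq', inter_eq_self_of_subset_right hOφ]

theorem IsChart.isModelOpen_image {φ : PartialEquiv M (E d)} (hφ : IsChart φ) {O : Set M}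
    (hO : IsOpen O) (hOφ : O ⊆ φ.source) : IsModelOpen (φ '' O) := by
  obtain ⟨U, hU, h⟩ := hφ.image_eq hO hOφ
  rw [h]
  exact hφ.isModelOpen_target.inter hU

theorem IsChart.image_mem_nhdsWithin {φ : PartialEquiv M (E d)} (hφ : IsChart φ) {O : Set M}
    (hO : IsOpen O) (hOφ : O ⊆ φ.source) {p : M} (hp : p ∈ O) :
    φ '' O ∈ nhdsWithin (φ p) φ.target := by
  obtain ⟨U, hU, h⟩ := hφ.image_eq hO hOφ
  have : φ p ∈ U ∩ φ.target := h ▸ mem_image_of_mem φ hp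
  rw [h]
  exact Filter.inter_mem (mem_nhdsWithin_of_mem_nhds (hU.mem_nhds this.1)) self_mem_nhdsWithin

theorem IsChart.measurableSet_image [MeasurableSpace M] [BorelSpace M] {φ : PartialEquiv M (E d)}
    (hφ : IsChart φ) {s : Set M} (hs : MeasurableSet s) (hsφ : s ⊆ φ.source) :
    MeasurableSet (φ '' s) := by
  rw [← inter_eq_self_of_subset_right hsφ, φ.image_source_inter_eq']
  exact hφ.continuousOn_symm.measurableSet_inter_preimage hφ.isModelOpen_target.measurableSet hs

end Charts

/-! ### Almost Euclidean charts. -/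

namespace LRStructure

variable {d : ℕ} [NeZero d] {M : Type u} [TopologicalSpace M]

/-- `φ` is a chart of the Lipschitz manifold defined on the open set `O`, in which the metric is
`b`-close to the Euclidean one. -/
structure IsEuclideanOn (S : LRStructure d M) (b : ℝ) (φ : PartialEquiv M (E d)) (O : Set M) :
    Prop where
  isLipChart : S.IsLipChart φ
  isOpen : IsOpen O
  subset_source : O ⊆ φ.source
  metric_bounds : ∀ α, ∀ᵐ z : E d, z ∈ φ '' (O ∩ (S.chart α).source) → ∀ ξ : E d,
    b⁻¹ * ‖ξ‖ ^ 2 ≤ S.metricInChart φ α z ξ ξ ∧ S.metricInChart φ α z ξ ξ ≤ b * ‖ξ‖ ^ 2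

namespace IsEuclideanOn

variable {S : LRStructure d M} {b : ℝ} {φ : PartialEquiv M (E d)} {O : Set M}

theorem isChart (h : S.IsEuclideanOn b φ O) : IsChart φ := h.isLipChart.1

theorem isModelOpen_image (h : S.IsEuclideanOn b φ O) : IsModelOpen (φ '' O) :=
  h.isChart.isModelOpen_image h.isOpen h.subset_source

theorem isModelOpen_image_inter (h : S.IsEuclideanOn b φ O) (α : S.A) :
    IsModelOpen (φ '' (O ∩ (S.chart α).source)) :=
  h.isChart.isModelOpen_image (h.isOpen.inter (S.isChart α).isOpen_source)
    (inter_subset_left.trans h.subset_source)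

theorem symm_apply (h : S.IsEuclideanOn b φ O) {p : M} (hp : p ∈ O) : φ.symm (φ p) = p :=
  φ.left_inv (h.subset_source hp)

theorem image_inter_subset (h : S.IsEuclideanOn b φ O) (α : S.A) :
    φ '' (O ∩ (S.chart α).source) ⊆ (φ.symm.trans (S.chart α)).source := by
  rintro _ ⟨p, ⟨hpO, hp⟩, rfl⟩
  simp [PartialEquiv.trans_source, φ.map_source (h.subset_source hpO), h.symm_apply hpO, hp]

theorem locallyLipschitzOn_transition (h : S.IsEuclideanOn b φ O) (α : S.A) :
    LocallyLipschitzOn (φ '' (O ∩ (S.chart α).source)) (φ.symm.trans (S.chart α)) :=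
  (h.isLipChart.2 α).1.mono (h.image_inter_subset α)

theorem transition_apply (h : S.IsEuclideanOn b φ O) (α : S.A) {p : M} (hp : p ∈ O) :
    φ.symm.trans (S.chart α) (φ p) = S.chart α p := by
  simp [h.symm_apply hp]

theorem ae_differentiableAt_transition (h : S.IsEuclideanOn b φ O) (α : S.A) :
    ∀ᵐ z, z ∈ φ '' (O ∩ (S.chart α).source) →
      DifferentiableAt ℝ (φ.symm.trans (S.chart α)) z :=
  (h.isModelOpen_image_inter α).ae_differentiableAt (h.locallyLipschitzOn_transition α)

end IsEuclideanOn

/-! ### Comparison of Riemannian volume and Lebesgue measure. -/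

section Volume

variable [MeasurableSpace M] [BorelSpace M]

theorem chartVol_apply (S : LRStructure d M) (α : S.A) {s : Set M} (hs : MeasurableSet s) :
    S.chartVol α s = ∫⁻ z in S.chart α '' ((S.chart α).source ∩ s),
      ENNReal.ofReal √(S.g α z).det := by
  have hm : AEMeasurable (S.chart α).symm (volume.restrict (S.chart α).target) :=
    (S.isChart α).continuousOn_symm.aemeasurable (S.isChart α).isModelOpen_target.measurableSet
  rw [chartVol, Measure.map_apply_of_aemeasurable
    (hm.mono_ac (withDensity_absolutelyContinuous _ _)) hs, withDensity_apply',
    Measure.restrict_restrict₀ (hm.nullMeasurableSet_preimage hs),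
    (S.chart α).image_source_inter_eq', inter_comm]

/-- The Lebesgue measure transported to the set `O` by the inverse of a chart. -/
noncomputable def chartLebesgue (φ : PartialEquiv M (E d)) (O : Set M) : Measure M :=
  (volume.restrict (φ '' O)).map φ.symm

namespace IsEuclideanOn

variable {S : LRStructure d M} {b : ℝ} {φ : PartialEquiv M (E d)} {O : Set M}

theorem aemeasurable_symm (h : S.IsEuclideanOn b φ O) :
    AEMeasurable φ.symm (volume.restrict (φ '' O)) :=
  (h.isChart.continuousOn_symm.mono
    (image_subset_iff.2 fun _ hp => φ.map_source (h.subset_source hp))).aemeasurable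
    h.isModelOpen_image.measurableSet

theorem chartLebesgue_apply (h : S.IsEuclideanOn b φ O) {s : Set M} (hs : MeasurableSet s) :
    chartLebesgue φ O s = volume (φ '' (O ∩ s)) := by
  rw [chartLebesgue, Measure.map_apply_of_aemeasurable h.aemeasurable_symm hs,
    Measure.restrict_apply₀ (h.aemeasurable_symm.nullMeasurableSet_preimage hs)]
  congr 1
  ext z
  constructor
  · rintro ⟨hz, p, hp, rfl⟩
    rw [mem_preimage, h.symm_apply hp] at hz
    exact ⟨p, ⟨hp, hz⟩, rfl⟩
  · rintro ⟨p, ⟨hp, hps⟩, rfl⟩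
    exact ⟨by rwa [mem_preimage, h.symm_apply hp], p, hp, rfl⟩

theorem ae_mem (h : S.IsEuclideanOn b φ O) : ∀ᵐ p ∂chartLebesgue φ O, p ∈ O := by
  change chartLebesgue φ O Oᶜ = 0
  simp [h.chartLebesgue_apply h.isOpen.measurableSet.compl]

theorem aemeasurable (h : S.IsEuclideanOn b φ O) : AEMeasurable φ (chartLebesgue φ O) := by
  rw [← Measure.restrict_eq_self_of_ae_mem h.ae_mem]
  exact (h.isChart.continuousOn.mono h.subset_source).aemeasurable h.isOpen.measurableSet

theorem map_chartLebesgue (h : S.IsEuclideanOn b φ O) :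
    (chartLebesgue φ O).map φ = volume.restrict (φ '' O) := by
  rw [chartLebesgue, AEMeasurable.map_map_of_aemeasurable h.aemeasurable h.aemeasurable_symm]
  conv_rhs => rw [← Measure.map_id (μ := volume.restrict (φ '' O))]
  refine Measure.map_congr ?_
  filter_upwards [ae_restrict_mem h.isModelOpen_image.measurableSet] with z hz
  obtain ⟨p, hp, rfl⟩ := hz
  simp [h.symm_apply hp]

theorem lintegral_chartLebesgue (h : S.IsEuclideanOn b φ O) {F : E d → ℝ≥0∞} (hF : Measurable F) :
    ∫⁻ p, F (φ p) ∂chartLebesgue φ O = ∫⁻ z in φ '' O, F z := by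
  rw [← h.map_chartLebesgue, lintegral_map' hF.aemeasurable h.aemeasurable]

theorem ae_chartLebesgue (h : S.IsEuclideanOn b φ O) {P : E d → Prop}
    (hP : ∀ᵐ z, z ∈ φ '' O → P z) : ∀ᵐ p ∂chartLebesgue φ O, P (φ p) := by
  rw [← ae_restrict_iff' h.isModelOpen_image.measurableSet, ← h.map_chartLebesgue] at hP
  exact ae_of_ae_map h.aemeasurable hP

/-- Change of variables along the transition map from `φ` to the chart `α`, applied to `φ '' s`: the
Jacobian times `√(det g_α)` lies between `b^{-d/2}` and `b^{d/2}`. -/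
theorem chartVol_mem_Icc (h : S.IsEuclideanOn b φ O) (hb : 0 < b) (α : S.A) {s : Set M}
    (hs : MeasurableSet s) (hsO : s ⊆ O) (hsα : s ⊆ (S.chart α).source) :
    S.chartVol α s ∈ Icc (ENNReal.ofReal (√(b ^ d))⁻¹ * chartLebesgue φ O s)
      (ENNReal.ofReal √(b ^ d) * chartLebesgue φ O s) := by
  have hZ : φ '' s ⊆ φ '' (O ∩ (S.chart α).source) := image_mono (subset_inter hsO hsα)
  have himg : S.chart α '' s = φ.symm.trans (S.chart α) '' (φ '' s) := by
    rw [image_image]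
    exact image_congr fun p hp => (h.transition_apply α (hsO hp)).symm
  rw [S.chartVol_apply α hs, h.chartLebesgue_apply hs, inter_eq_self_of_subset_right hsα,
    inter_eq_self_of_subset_right hsO, himg]
  refine lintegral_sqrt_det_image_mem_Icc
    (h.isChart.measurableSet_image hs (hsO.trans h.subset_source))
    ((h.locallyLipschitzOn_transition α).mono hZ)
    ((φ.symm.trans (S.chart α)).injOn.mono (hZ.trans (h.image_inter_subset α))) ?_ ?_ hb ?_
  · filter_upwards [h.ae_differentiableAt_transition α] with z hz hzs using hz (hZ hzs)
  · rintro _ ⟨p, hp, rfl⟩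
    rw [h.transition_apply α (hsO hp)]
    exact S.posDef_g α _ ((S.chart α).map_source (hsα hp))
  · filter_upwards [h.metric_bounds α] with z hz hzs using hz (hZ hzs)

/-- The comparison is available only inside one atlas chart at a time. A countable disjoint
refinement of the atlas cuts `s` into such pieces, and on each of them `vol` dominates the chart
measure. -/
theorem smul_chartLebesgue_le_vol (h : S.IsEuclideanOn b φ O) (hb : 0 < b) :
    ENNReal.ofReal (√(b ^ d))⁻¹ • chartLebesgue φ O ≤ S.vol.restrict O := by
  have := S.countable_A
  rcases isEmpty_or_nonempty M with hM | ⟨⟨p₀⟩⟩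
  · exact Measure.le_iff.2 fun s _ => by simp [eq_empty_of_isEmpty s]
  have : Nonempty S.A := ⟨(S.cover p₀).choose⟩
  obtain ⟨e, he⟩ := exists_surjective_nat S.A
  set U : ℕ → Set M := fun n => (S.chart (e n)).source with hU
  have hUm : ∀ n, MeasurableSet (U n) := fun n => (S.isChart _).isOpen_source.measurableSet
  have hcover : ⋃ n, disjointed U n = univ := by
    rw [iUnion_disjointed, eq_univ_iff_forall]
    intro p
    obtain ⟨α, hα⟩ := S.cover p
    obtain ⟨n, rfl⟩ := he α
    exact mem_iUnion.2 ⟨n, hα⟩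
  refine Measure.le_iff.2 fun s hs => ?_
  have hsplit : ∀ μ : Measure M, μ s = ∑' n, μ (s ∩ disjointed U n) := fun μ => by
    rw [← measure_iUnion (fun i j hij => ((disjoint_disjointed U) hij).mono
      inter_subset_right inter_subset_right) fun n => hs.inter (.disjointed hUm n),
      ← inter_iUnion, hcover, inter_univ]
  rw [hsplit, hsplit (S.vol.restrict O)]
  refine ENNReal.tsum_le_tsum fun n => ?_
  have hm : MeasurableSet (s ∩ disjointed U n ∩ O) :=
    (hs.inter (.disjointed hUm n)).inter h.isOpen.measurableSet
  rw [Measure.restrict_apply (hs.inter (.disjointed hUm n)), Measure.smul_apply, smul_eq_mul,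
    ← Measure.restrict_eq_self_of_ae_mem h.ae_mem,
    Measure.restrict_apply (hs.inter (.disjointed hUm n))]
  exact (h.chartVol_mem_Icc hb (e n) hm inter_subset_right
    ((inter_subset_left.trans inter_subset_right).trans (disjointed_subset U n))).1.trans
    (le_iSup S.chartVol (e n) _)

/-- As `vol` is a least upper bound of measures, it suffices to dominate each chart measure by one
global measure; the summand `S.vol.restrict Oᶜ` takes care of the part outside `O` and disappears on
restriction. -/
theorem vol_restrict_le (h : S.IsEuclideanOn b φ O) (hb : 0 < b) :
    S.vol.restrict O ≤ ENNReal.ofReal √(b ^ d) • chartLebesgue φ O := by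
  have hO := h.isOpen.measurableSet
  have hle : S.vol ≤ ENNReal.ofReal √(b ^ d) • chartLebesgue φ O + S.vol.restrict Oᶜ := by
    refine iSup_le fun α => Measure.le_iff.2 fun s hs => ?_
    have hU : MeasurableSet (S.chart α).source := (S.isChart α).isOpen_source.measurableSet
    have h0 : S.chartVol α (S.chart α).sourceᶜ = 0 := by simp [S.chartVol_apply α hU.compl]
    rw [← measure_inter_add_sdiff s hO, Measure.add_apply]
    gcongr ?_ + ?_
    · calc S.chartVol α (s ∩ O)
          ≤ S.chartVol α (s ∩ O ∩ (S.chart α).source) + S.chartVol α (S.chart α).sourceᶜ := by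
            refine (measure_mono fun p hp => ?_).trans (measure_union_le _ _)
            by_cases hpα : p ∈ (S.chart α).source
            · exact Or.inl ⟨hp, hpα⟩
            · exact Or.inr hpα
        _ ≤ ENNReal.ofReal √(b ^ d) * chartLebesgue φ O (s ∩ O ∩ (S.chart α).source) := by
            rw [h0, add_zero]
            exact (h.chartVol_mem_Icc hb α ((hs.inter hO).inter hU)
              (inter_subset_left.trans inter_subset_right) inter_subset_right).2
        _ ≤ _ := by
            rw [Measure.smul_apply, smul_eq_mul]
            gcongr
            exact inter_subset_left.trans inter_subset_left
    · rw [Measure.restrict_apply hs]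
      exact le_iSup S.chartVol α _
  refine (Measure.restrict_mono le_rfl hle).trans ?_
  rw [Measure.restrict_add, Measure.restrict_restrict hO, inter_compl_self,
    Measure.restrict_empty, add_zero]
  exact Measure.restrict_le_self

end IsEuclideanOn

end Volume

/-! ### Functions and gradients read in a chart. -/

section Functions

variable {S : LRStructure d M} {b : ℝ} {φ : PartialEquiv M (E d)} {O : Set M} {f : M → ℝ}

/-- The function `f` on `O` read in the chart `φ` and extended by zero. -/
noncomputable def readInChart (φ : PartialEquiv M (E d)) (O : Set M) (f : M → ℝ) : E d → ℝ :=
  (φ '' O).indicator (f ∘ φ.symm)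

namespace IsEuclideanOn

theorem readInChart_apply (h : S.IsEuclideanOn b φ O) {p : M} (hp : p ∈ O) :
    readInChart φ O f (φ p) = f p := by
  rw [readInChart, indicator_of_mem (mem_image_of_mem φ hp), Function.comp_apply, h.symm_apply hp]

theorem readInChart_eqOn (h : S.IsEuclideanOn b φ O) (α : S.A) :
    EqOn (readInChart φ O f) ((f ∘ (S.chart α).symm) ∘ φ.symm.trans (S.chart α))
      (φ '' (O ∩ (S.chart α).source)) := by
  rintro _ ⟨p, hp, rfl⟩
  rw [h.readInChart_apply hp.1, Function.comp_apply, h.transition_apply α hp.1,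
    Function.comp_apply, (S.chart α).left_inv hp.2]

theorem locallyLipschitzOn_readInChart (h : S.IsEuclideanOn b φ O)
    (hf : ∀ α, LocallyLipschitzOn (S.chart α).target (f ∘ (S.chart α).symm)) :
    LocallyLipschitzOn (φ '' O) (readInChart φ O f) := by
  rintro _ ⟨p, hp, rfl⟩
  obtain ⟨α, hα⟩ := S.cover p
  have hmaps : MapsTo (φ.symm.trans (S.chart α)) (φ '' (O ∩ (S.chart α).source))
      (S.chart α).target := by
    rintro _ ⟨q, hq, rfl⟩
    rw [h.transition_apply α hq.1]
    exact (S.chart α).map_source hq.2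
  obtain ⟨K, t, ht, hK⟩ := (hf α).comp (h.locallyLipschitzOn_transition α) hmaps
    (mem_image_of_mem φ ⟨hp, hα⟩)
  have hW : φ '' (O ∩ (S.chart α).source) ∈ nhdsWithin (φ p) (φ '' O) :=
    nhdsWithin_mono _ (by
      rintro _ ⟨q, hq, rfl⟩
      exact φ.map_source (h.subset_source hq)) <|
      h.isChart.image_mem_nhdsWithin (h.isOpen.inter (S.isChart α).isOpen_source)
        (inter_subset_left.trans h.subset_source) ⟨hp, hα⟩
  refine ⟨K, t ∩ φ '' (O ∩ (S.chart α).source), Filter.inter_mem ?_ hW, ?_⟩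
  · exact (nhdsWithin_le_of_mem hW) ht
  · exact fun x hx y hy => by
      rw [h.readInChart_eqOn α hx.2, h.readInChart_eqOn α hy.2]
      exact hK hx.1 hy.1

/-- Almost everywhere, the Euclidean gradient is controlled by the Riemannian one. -/
theorem ae_enorm_fderiv_readInChart_sq_le (h : S.IsEuclideanOn b φ O) (hb : 0 < b)
    (hf : ∀ α, LocallyLipschitzOn (S.chart α).target (f ∘ (S.chart α).symm)) :
    ∀ᵐ z, z ∈ φ '' O →
      ‖fderiv ℝ (readInChart φ O f) z‖ₑ ^ 2 ≤ ENNReal.ofReal b * S.gradSq f (φ.symm z) := by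
  have := S.countable_A
  have key : ∀ α, ∀ᵐ z, z ∈ φ '' (O ∩ (S.chart α).source) →
      ‖fderiv ℝ (readInChart φ O f) z‖ₑ ^ 2 ≤ ENNReal.ofReal b * S.gradSq f (φ.symm z) := by
    intro α
    have hdiff : ∀ᵐ z, z ∈ φ '' (O ∩ (S.chart α).source) →
        DifferentiableAt ℝ (f ∘ (S.chart α).symm) (φ.symm.trans (S.chart α) z) := by
      -- The non-differentiability points form a null set in the chart `α`; the transition map to
      -- `φ` is locally Lipschitz and keeps it null.
      set Y := {w | w ∈ ((S.chart α).symm.trans φ).source ∧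
        ¬ DifferentiableAt ℝ (f ∘ (S.chart α).symm) w}
      have hY : volume Y = 0 := by
        refine measure_mono_null ?_
          ((S.isChart α).isModelOpen_target.ae_differentiableAt (hf α))
        rintro w ⟨hw1, hw2⟩ hw3
        exact hw2 (hw3 (by simpa using hw1.1))
      have hY2 := (h.isLipChart.2 α).2.measure_image_eq_zero (t := Y) (fun w hw => hw.1) hY
      filter_upwards [measure_eq_zero_iff_ae_notMem.1 hY2] with z hz hzW
      by_contra hn
      obtain ⟨p, hp, rfl⟩ := hzW
      rw [h.transition_apply α hp.1] at hn
      refine hz ⟨S.chart α p, ⟨?_, hn⟩, ?_⟩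
      · simp [PartialEquiv.trans_source, (S.chart α).map_source hp.2, (S.chart α).left_inv hp.2,
          h.subset_source hp.1]
      · simp [(S.chart α).left_inv hp.2]
    filter_upwards [(h.isModelOpen_image_inter α).ae_mem_nhds_of_mem,
      h.ae_differentiableAt_transition α, h.metric_bounds α, hdiff] with z h1 h2 h3 h4 hz
    have hG : (S.g α (φ.symm.trans (S.chart α) z)).PosDef := by
      obtain ⟨p, hp, rfl⟩ := hz
      rw [h.transition_apply α hp.1]
      exact S.posDef_g α _ ((S.chart α).map_source hp.2)
    have hle := norm_fderiv_sq_le_conormSq hG hb.le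
      (Filter.mem_of_superset (h1 hz) (h.readInChart_eqOn (f := f) α)) (h2 hz) (h4 hz)
      fun ξ => (h3 hz ξ).2
    rw [← ofReal_norm, ← ENNReal.ofReal_pow (norm_nonneg _)]
    refine (ENNReal.ofReal_le_ofReal hle).trans ?_
    rw [ENNReal.ofReal_mul hb.le]
    gcongr
    have hzα : φ.symm z ∈ (S.chart α).source := by
      obtain ⟨p, hp, rfl⟩ := hz
      rw [h.symm_apply hp.1]
      exact hp.2
    exact le_iSup₂ (f := fun (α : S.A) (_ : φ.symm z ∈ (S.chart α).source) =>
      ENNReal.ofReal (conormSq (S.g α (S.chart α (φ.symm z)))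
        (dCoeff (f ∘ (S.chart α).symm) (S.chart α (φ.symm z))))) α hzα
  filter_upwards [ae_all_iff.2 key] with z hz hzO
  obtain ⟨p, hp, rfl⟩ := hzO
  obtain ⟨α, hα⟩ := S.cover p
  exact hz α ⟨p, ⟨hp, hα⟩, rfl⟩

theorem measurable_readInChart (h : S.IsEuclideanOn b φ O)
    (hf : ∀ α, LocallyLipschitzOn (S.chart α).target (f ∘ (S.chart α).symm)) :
    Measurable (readInChart φ O f) := by
  classical
  have h1 : readInChart φ O f = (φ '' O).piecewise (readInChart φ O f) fun _ => 0 := by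
    ext z
    by_cases hz : z ∈ φ '' O
    · simp only [piecewise_eq_of_mem _ _ _ hz]
    · rw [piecewise_eq_of_notMem _ _ _ hz, readInChart, indicator_of_notMem hz]
  rw [h1]
  exact (h.locallyLipschitzOn_readInChart hf).continuousOn.measurable_piecewise continuousOn_const
    h.isModelOpen_image.measurableSet

variable [MeasurableSpace M] [BorelSpace M]

theorem lintegral_fderiv_readInChart_le_energy (h : S.IsEuclideanOn b φ O) (hb : 0 < b)
    (hf : ∀ α, LocallyLipschitzOn (S.chart α).target (f ∘ (S.chart α).symm)) :
    ENNReal.ofReal (√(b ^ d))⁻¹ * ∫⁻ z in φ '' O, ‖fderiv ℝ (readInChart φ O f) z‖ₑ ^ 2 ≤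
      ENNReal.ofReal b * S.energy f := by
  have hm : Measurable fun z => ‖fderiv ℝ (readInChart φ O f) z‖ₑ ^ 2 :=
    (measurable_fderiv ℝ _).enorm.pow_const 2
  calc _ = ∫⁻ p, ‖fderiv ℝ (readInChart φ O f) (φ p)‖ₑ ^ 2
        ∂(ENNReal.ofReal (√(b ^ d))⁻¹ • chartLebesgue φ O) := by
        rw [lintegral_smul_measure, h.lintegral_chartLebesgue hm, smul_eq_mul]
    _ ≤ ∫⁻ p, ENNReal.ofReal b * S.gradSq f p
        ∂(ENNReal.ofReal (√(b ^ d))⁻¹ • chartLebesgue φ O) := by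
        refine lintegral_mono_ae (Measure.ae_smul_measure ?_ _)
        filter_upwards [h.ae_mem, h.ae_chartLebesgue (h.ae_enorm_fderiv_readInChart_sq_le hb hf)]
          with p hp hpf
        rwa [h.symm_apply hp] at hpf
    _ ≤ ∫⁻ p, ENNReal.ofReal b * S.gradSq f p ∂S.vol :=
        lintegral_mono' ((h.smul_chartLebesgue_le_vol hb).trans Measure.restrict_le_self) le_rfl
    _ = _ := lintegral_const_mul' _ _ ENNReal.ofReal_ne_top

end IsEuclideanOn

end Functions

end LRStructure

end LRMfd

/-! ### Rayleigh quotients, the Faber–Krahn constant and admissible balls. -/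

namespace LRMfd

namespace LRStructure

variable {d : ℕ} [NeZero d] {M : Type u} [TopologicalSpace M] [MeasurableSpace M]
  {S : LRStructure d M} {b : ℝ} {φ : PartialEquiv M (E d)} {O : Set M} {f : M → ℝ}

theorem normSq_eq_setLIntegral (hfO : tsupport f ⊆ O) :
    S.normSq f = ∫⁻ p in O, ‖f p‖ₑ ^ 2 ∂S.vol := by
  rw [setLIntegral_eq_of_support_subset fun p hp => hfO (subset_tsupport f (by simpa using hp))]
  refine lintegral_congr fun p => ?_
  rw [← ofReal_norm, ← ENNReal.ofReal_pow (norm_nonneg _), Real.norm_eq_abs, sq_abs]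

namespace IsEuclideanOn

variable [BorelSpace M]

theorem lintegral_sq_chartLebesgue (h : S.IsEuclideanOn b φ O) (hf : S.IsTestFunction O f) :
    ∫⁻ p, ‖f p‖ₑ ^ 2 ∂chartLebesgue φ O = ∫⁻ z in φ '' O, ‖readInChart φ O f z‖ₑ ^ 2 := by
  rw [← h.lintegral_chartLebesgue ((h.measurable_readInChart hf.lipschitz).enorm.pow_const 2)]
  refine lintegral_congr_ae ?_
  filter_upwards [h.ae_mem] with p hp
  rw [h.readInChart_apply hp]

theorem normSq_le (h : S.IsEuclideanOn b φ O) (hb : 0 < b) (hf : S.IsTestFunction O f) :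
    S.normSq f ≤ ENNReal.ofReal √(b ^ d) * ∫⁻ z in φ '' O, ‖readInChart φ O f z‖ₑ ^ 2 := by
  rw [normSq_eq_setLIntegral hf.support_subset, ← h.lintegral_sq_chartLebesgue hf, ← smul_eq_mul,
    ← lintegral_smul_measure]
  exact lintegral_mono' (h.vol_restrict_le hb) le_rfl

theorem le_normSq (h : S.IsEuclideanOn b φ O) (hb : 0 < b) (hf : S.IsTestFunction O f) :
    ENNReal.ofReal (√(b ^ d))⁻¹ * ∫⁻ z in φ '' O, ‖readInChart φ O f z‖ₑ ^ 2 ≤ S.normSq f := by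
  rw [normSq_eq_setLIntegral hf.support_subset, ← h.lintegral_sq_chartLebesgue hf, ← smul_eq_mul,
    ← lintegral_smul_measure]
  exact lintegral_mono' (h.smul_chartLebesgue_le_vol hb) le_rfl

theorem volume_image_le (h : S.IsEuclideanOn b φ O) (hb : 0 < b) :
    volume (φ '' O) ≤ ENNReal.ofReal √(b ^ d) * S.vol O := by
  have hκ : 0 < √(b ^ d) := by positivity
  have h1 := h.smul_chartLebesgue_le_vol hb O
  rw [Measure.smul_apply, h.chartLebesgue_apply h.isOpen.measurableSet, inter_self,
    Measure.restrict_apply_self, smul_eq_mul, ENNReal.ofReal_inv_of_pos hκ] at h1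
  rwa [← ENNReal.inv_mul_le_iff (by simpa using hκ) ENNReal.ofReal_ne_top]

/-- The Faber–Krahn estimate for test functions in an almost Euclidean chart. -/
theorem normSq_le_energy (h : S.IsEuclideanOn b φ O) (hb : 0 < b) (hf : S.IsTestFunction O f)
    (hfin : S.normSq f ≠ ∞) {ρ : ℝ} (hρ : 0 < ρ)
    (hvol : 4 * ENNReal.ofReal √(b ^ d) * S.vol O ≤ ENNReal.ofReal (ρ ^ d) * halfBallVolume d) :
    S.normSq f ≤ ENNReal.ofReal (2 * b * √(b ^ d) ^ 2 * ρ ^ 2) * S.energy f := by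
  have hκ : 0 < √(b ^ d) := by positivity
  set κ := √(b ^ d)
  set u := readInChart φ O f
  have hK : IsCompact (φ '' tsupport f) := hf.compactSupport.isCompact.image_of_continuousOn
    (h.isChart.continuousOn.mono (hf.support_subset.trans h.subset_source))
  have huK : ∀ z ∉ φ '' tsupport f, u z = 0 := fun z hz => by
    by_cases hzO : z ∈ φ '' O
    · obtain ⟨p, hp, rfl⟩ := hzO
      rw [show u (φ p) = f p from h.readInChart_apply hp]
      exact image_eq_zero_of_notMem_tsupport fun hpf => hz ⟨p, hpf, rfl⟩
    · exact indicator_of_notMem hzO _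
  have hκ0 : ENNReal.ofReal κ ≠ 0 := by simpa using hκ
  have hlow := h.le_normSq hb hf
  have hen := h.lintegral_fderiv_readInChart_le_energy hb hf.lipschitz
  rw [ENNReal.ofReal_inv_of_pos hκ, ENNReal.inv_mul_le_iff hκ0 ENNReal.ofReal_ne_top] at hlow hen
  -- Finiteness of the Euclidean mass is what the absorption argument requires.
  have hI : ∫⁻ z in φ '' O, ‖u z‖ₑ ^ 2 ≠ ∞ :=
    ne_top_of_le_ne_top (ENNReal.mul_ne_top ENNReal.ofReal_ne_top hfin) hlow
  have hFK := h.isModelOpen_image.lintegral_sq_le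
    (h.locallyLipschitzOn_readInChart hf.lipschitz) hK (image_mono hf.support_subset) huK hρ
    (le_trans (by rw [mul_assoc]; gcongr; exact h.volume_image_le hb) hvol) hI
  calc S.normSq f ≤ ENNReal.ofReal κ * ∫⁻ z in φ '' O, ‖u z‖ₑ ^ 2 := h.normSq_le hb hf
    _ ≤ ENNReal.ofReal κ * (2 * ENNReal.ofReal ρ ^ 2 *
        (ENNReal.ofReal κ * (ENNReal.ofReal b * S.energy f))) := by
        gcongr
        exact hFK.trans (by gcongr)
    _ = _ := by
        rw [ENNReal.ofReal_mul (by positivity), ENNReal.ofReal_mul (by positivity),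
          ENNReal.ofReal_mul (by positivity), ENNReal.ofReal_pow hκ.le, ENNReal.ofReal_pow hρ.le,
          ENNReal.ofReal_ofNat]
        ring

end IsEuclideanOn

/-- The constant in the Faber–Krahn inequality. -/
noncomputable def faberKrahnConst (d : ℕ) [NeZero d] (b : ℝ) : ℝ :=
  (2 * b * √(b ^ d) ^ 2)⁻¹ * (4 * √(b ^ d) / (halfBallVolume d).toReal) ^ (-(2 : ℝ) / d)

theorem halfBallVolume_toReal_pos : 0 < (halfBallVolume d).toReal :=
  ENNReal.toReal_pos halfBallVolume_ne_zero halfBallVolume_ne_top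

theorem faberKrahnConst_pos (hb : 0 < b) : 0 < faberKrahnConst d b := by
  have := halfBallVolume_toReal_pos (d := d)
  unfold faberKrahnConst
  positivity

theorem IsEuclideanOn.le_lambda1 [BorelSpace M] (h : S.IsEuclideanOn b φ O) (hb : 0 < b) :
    ENNReal.ofReal (faberKrahnConst d b) * S.vol O ^ (-(2 : ℝ) / d) ≤ S.lambda1 O := by
  have hβ := halfBallVolume_toReal_pos (d := d)
  have hd : (0 : ℝ) < d := Nat.cast_pos.2 (NeZero.pos d)
  refine le_iInf₂ fun f hf => ?_
  obtain ⟨hf, hf0, hfin⟩ := hf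
  have hexp : -(2 : ℝ) / d < 0 := div_neg_of_neg_of_pos (by norm_num) hd
  rcases eq_or_ne (S.vol O) ∞ with htop | htop
  -- For infinite volume the negative power is `0`, and the bound is trivial.
  · simp [htop, ENNReal.top_rpow_of_neg hexp]
  have hv0 : S.vol O ≠ 0 := fun h0 => hf0 <| by
    rw [normSq_eq_setLIntegral hf.support_subset, Measure.restrict_eq_zero.2 h0,
      lintegral_zero_measure]
  set v := (S.vol O).toReal with hv
  have hvpos : 0 < v := ENNReal.toReal_pos hv0 htop
  have hvO : S.vol O = ENNReal.ofReal v := (ENNReal.ofReal_toReal htop).symm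
  set κ := √(b ^ d) with hκd
  have hκ : 0 < κ := by positivity
  set β := (halfBallVolume d).toReal with hβd
  have hβO : halfBallVolume d = ENNReal.ofReal β :=
    (ENNReal.ofReal_toReal halfBallVolume_ne_top).symm
  -- The smallest radius allowed by `normSq_le_energy`: its volume condition holds with equality, `ρ
  -- ^ d * β = 4 * κ * v`. Then `ρ ^ 2` carries the factor `v ^ (2 / d)`.
  set ρ : ℝ := (4 * κ / β * v) ^ ((d : ℝ)⁻¹) with hρ
  have hbase : 0 < 4 * κ / β * v := by positivity
  have hρpos : 0 < ρ := by positivity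
  have hρd : ρ ^ d = 4 * κ / β * v := Real.rpow_inv_natCast_pow hbase.le (NeZero.ne d)
  have hle := h.normSq_le_energy hb hf hfin hρpos (by
    rw [hρd, hvO, hβO, ← ENNReal.ofReal_ofNat 4, ← ENNReal.ofReal_mul (by positivity),
      ← ENNReal.ofReal_mul (by positivity), ← ENNReal.ofReal_mul (by positivity)]
    exact ENNReal.ofReal_le_ofReal (by field_simp; rfl))
  have hconst : ENNReal.ofReal (faberKrahnConst d b) * S.vol O ^ (-(2 : ℝ) / d) =
      (ENNReal.ofReal (2 * b * κ ^ 2 * ρ ^ 2))⁻¹ := by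
    have e : ρ ^ 2 = ((4 * κ / β * v) ^ (-(2 : ℝ) / d))⁻¹ := by
      rw [← Real.rpow_neg hbase.le, hρ, ← Real.rpow_natCast, ← Real.rpow_mul hbase.le]
      congr 1
      push_cast
      ring
    rw [hvO, ENNReal.ofReal_rpow_of_pos hvpos,
      ← ENNReal.ofReal_mul (faberKrahnConst_pos hb).le,
      ← ENNReal.ofReal_inv_of_pos (by positivity), e, mul_inv _ (_ ^ (-(2 : ℝ) / _))⁻¹, inv_inv,
      Real.mul_rpow (by positivity) hvpos.le, faberKrahnConst, mul_assoc]
  rw [hconst, ENNReal.le_div_iff_mul_le (Or.inl hf0) (Or.inl hfin),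
    ENNReal.inv_mul_le_iff (by simpa using by positivity) ENNReal.ofReal_ne_top]
  exact hle

/-- Dividing by `ε₂ > 1` makes the radius strictly smaller than the supremum defining `euclRadius`,
so some admissible radius exceeds it, whether or not the supremum is attained. -/
theorem exists_isAdmissible_of_R_pos {ε₁ ε₂ : ℝ} (h₂ : 1 < ε₂) {x : M} (hR : 0 < S.R b ε₁ ε₂ x) :
    ∃ r, S.IsAdmissible b x r ∧ S.ball x (S.R b ε₁ ε₂ x) ⊆ S.ball x r := by
  set m := min (S.euclRadius x b) (ENNReal.ofReal ε₁) with hm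
  have hR' : S.R b ε₁ ε₂ x = m.toReal / ε₂ := rfl
  have hε : 0 < ε₂ := zero_lt_one.trans h₂
  have hmpos : 0 < m.toReal := by
    rw [hR'] at hR
    exact (div_pos_iff_of_pos_right hε).1 hR
  have hlt : ENNReal.ofReal (S.R b ε₁ ε₂ x) < S.euclRadius x b :=
    calc ENNReal.ofReal (S.R b ε₁ ε₂ x) < ENNReal.ofReal m.toReal := by
          rw [hR', ENNReal.ofReal_lt_ofReal_iff hmpos]
          exact div_lt_self hmpos h₂
      _ ≤ m := ENNReal.ofReal_toReal_le
      _ ≤ _ := min_le_left _ _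
  obtain ⟨r, hr⟩ := lt_iSup_iff.1 hlt
  obtain ⟨hadm, hr⟩ := lt_iSup_iff.1 hr
  exact ⟨r, hadm, fun y hy => lt_trans (α := ℝ≥0∞) hy hr⟩

theorem ball_eq_empty (x : M) {r : ℝ} (hr : r ≤ 0) : S.ball x r = ∅ := by
  ext y
  simp [ball, ENNReal.ofReal_of_nonpos hr]

theorem IsAdmissible.exists_isEuclideanOn {x : M} {r : ℝ} (h : S.IsAdmissible b x r)
    (hO : IsOpen O) (hOr : O ⊆ S.ball x r) : ∃ φ, S.IsEuclideanOn b φ O := by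
  obtain ⟨φ, hφ, -, hsub, -, hmet⟩ := h.exists_chart
  refine ⟨φ, hφ, hO, hOr.trans hsub, fun α => ?_⟩
  filter_upwards [hmet α] with z hz hzO
  exact hz (image_mono (inter_subset_inter_left _ hOr) hzO)

end LRStructure

end LRMfd

theorem mainTheorem11 (d : ℕ) [NeZero d] (b : ℝ) (hb : 1 < b) :
    ∃ a : ℝ, 0 < a ∧
      ∀ (M : Type u) [TopologicalSpace M] [T2Space M] [SecondCountableTopology M]
        [ConnectedSpace M] [MeasurableSpace M] [BorelSpace M] (S : LRMfd.LRStructure d M)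
        (ε₁ ε₂ : ℝ), 0 < ε₁ → 1 < ε₂ → ∀ x : M,
          IsCompact (closure (S.ball x (S.R b ε₁ ε₂ x))) ∧
          ∀ O : Set M, IsOpen O → O.Nonempty → O ⊆ S.ball x (S.R b ε₁ ε₂ x) →
            ENNReal.ofReal a * S.vol O ^ (-(2 : ℝ) / (d : ℝ)) ≤ S.lambda1 O := by
  have hb0 : 0 < b := zero_lt_one.trans hb
  refine ⟨LRMfd.LRStructure.faberKrahnConst d b, LRMfd.LRStructure.faberKrahnConst_pos hb0, ?_⟩
  intro M _ _ _ _ _ _ S ε₁ ε₂ _ h₂ x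
  -- A vanishing Euclidean radius gives `R = 0` and an empty ball, which contains no nonempty `O`.
  rcases le_or_gt (S.R b ε₁ ε₂ x) 0 with hR | hR
  · rw [LRMfd.LRStructure.ball_eq_empty x hR]
    exact ⟨by simp, fun O _ hne hO => absurd (hne.mono hO) Set.not_nonempty_empty⟩
  obtain ⟨r, hr, hball⟩ := LRMfd.LRStructure.exists_isAdmissible_of_R_pos h₂ hR
  refine ⟨hr.relativelyCompact.of_isClosed_subset isClosed_closure (closure_mono hball), ?_⟩
  intro O hO _ hsub
  obtain ⟨φ, hφ⟩ := hr.exists_isEuclideanOn hO (hsub.trans hball)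
  exact hφ.le_lambda1 hb0
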